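/- **Notation.** For $s\in\mathbf R$, $h>0$ let $\mathcal S_{s,h}(\mathbf R^d)$ be the space of all $f\in C^\infty(\mathbf R^d)$ with $$\|f\|_{\mathcal S_{s,h}}=\sup_{\alpha,\beta\in\mathbf N^d,\;x\in\mathbf R^d}\frac{|x^\beta\partial^\alpha f(x)|}{h^{|\alpha|+|\beta|}(\alpha!\,\beta!)^s}<\infty .$$ Let $\mathcal S_s(\mathbf R^d)=\bigcup_{h>0}\mathcal S_{s,h}(\mathbf R^d)$ with the strongest topology for which all inclusions $\mathcal S_{s,h}\to\mathcal S_s$ are continuous, and $\Sigma_s(\mathbf R^d)=\bigcap_{h>0}\mathcal S_{s,h}(\mathbf R^d)$ with the topology defined by the norms $\|\cdot\|_{\mathcal S_{s,h}}$, $h>0$. Let $\mathcal S_s'$, $\Sigma_s'$ be the (strong) dual spaces, and let $\mathscr S$, $\mathscr S'$ be the Schwartz space and the space of tempered distributions. Functions are identified with distributions through $\langle f,g\rangle=\int f g\,dx$, and $A\hookrightarrow B$ means that $A$ is continuously embedded in $B$ (compatibly with the inclusions in $\mathcal S_{1/2}'$). A *quasi-norm* on a complex vector space $\mathscr B$ is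 a map $\|\cdot\|:\mathscr B\to[0,\infty)$ with $\|f\|=0\iff f=0$, $\|cf\|=|c|\,\|f\|$ for $c\in\mathbf C$, and $\|f+g\|\le D(\|f\|+\|g\|)$ for some constant $D\ge1$; $\mathscr B$ is a *quasi-Banach space* if it is complete in the topology defined by the quasi-norm. For a linear map $T:\mathscr B_1\to\mathscr B_2$ between quasi-Banach spaces, its singular values are $$\sigma_j(T)=\inf\{\|T-T_0\|_{\mathscr B_1\to\mathscr B_2}:\ T_0:\mathscr B_1\to\mathscr B_2\text{ linear},\ \operatorname{rank}T_0\le j-1\},\qquad j\ge1,$$ and $T\in\mathscr I_p(\mathscr B_1,\mathscr B_2)$, $p\in(0,\infty]$, means that $(\sigma_j(T))_{j\ge1}\in\ell^p$. For a kernel $K$ on $\mathbf R^{d_2+d_1}$ belonging to $\mathcal S_s$ (resp. $\Sigma_s$, $\mathscr S$), $T_K$ is the operator from $\mathcal S_s'(\mathbf R^{d_1})$ to $\mathcal S_s(\mathbf R^{d_2})$ (resp. from $\Sigma_s'$ to $\Sigma_s$, from $\mathscr S'$ to $\mathscr S$) given by $(T_Kf)(x)=\langle f,K(x,\cdot)\rangle$,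 that is, $(T_Kf)(x)=\int K(x,y)f(y)\,dy$ when $f$ is a test function. When $\mathscr B_1\hookrightarrow\mathcal S_s'(\mathbf R^{d_1})$ and $\mathcal S_s(\mathbf R^{d_2})\hookrightarrow\mathscr B_2$ (and similarly in the other two cases), it is regarded as an operator from $\mathscr B_1$ to $\mathscr B_2$. **Theorem.** Let $\mathscr B_1$ and $\mathscr B_2$ be quasi-Banach spaces such that $$\mathcal S_{1/2}(\mathbf R^{d_j})\hookrightarrow\mathscr B_j\hookrightarrow\mathcal S_{1/2}'(\mathbf R^{d_j}),\qquad j=1,2,$$ and let $p\in(0,\infty]$. Then the following is true: 1. if $s\ge 1/2$, $\mathscr B_1\hookrightarrow\mathcal S_s'(\mathbf R^{d_1})$, $\mathcal S_s(\mathbf R^{d_2})\hookrightarrow\mathscr B_2$, and $K\in\mathcal S_s(\mathbf R^{d_2+d_1})$, then $T_K\in\mathscr I_p(\mathscr B_1,\mathscr B_2)$; 2. if $s>1/2$, $\mathscr B_1\hookrightarrow\Sigma_s'(\mathbf R^{d_1})$, $\Sigma_s(\mathbf R^{d_2})\hookrightarrow\mathscr B_2$, and $K\in\Sigma_s(\mathbf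 R^{d_2+d_1})$, then $T_K\in\mathscr I_p(\mathscr B_1,\mathscr B_2)$; 3. if $\mathscr B_1\hookrightarrow\mathscr S'(\mathbf R^{d_1})$, $\mathscr S(\mathbf R^{d_2})\hookrightarrow\mathscr B_2$, and $K\in\mathscr S(\mathbf R^{d_2+d_1})$, then $T_K\in\mathscr I_p(\mathscr B_1,\mathscr B_2)$. -/

import Mathlib

open MeasureTheory
open scoped ENNReal SchwartzMap LineDeriv

noncomputable section

namespace GSKernel

/-! ### Multi-indices and Gelfand-Shilov norms -/

/-- Euclidean space `ℝ^d`. -/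
abbrev RPt (d : ℕ) : Type := EuclideanSpace ℝ (Fin d)

/-- The partial derivative `∂_i` as an operator on Schwartz functions. -/
def partialD {d : ℕ} (i : Fin d) : 𝓢(RPt d, ℂ) →L[ℂ] 𝓢(RPt d, ℂ) :=
  LineDeriv.lineDerivOpCLM ℂ 𝓢(RPt d, ℂ) (EuclideanSpace.single i (1 : ℝ))

/-- `∂^α = ∂_1^{α_1} ⋯ ∂_d^{α_d}` for a multi-index `α`. -/
def multiD {d : ℕ} (α : Fin d → ℕ) : 𝓢(RPt d, ℂ) →L[ℂ] 𝓢(RPt d, ℂ) :=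
  ((List.finRange d).map fun i => partialD i ^ α i).prod

/-- `|α| = α_1 + ⋯ + α_d`. -/
def multiLength {d : ℕ} (α : Fin d → ℕ) : ℕ := ∑ i, α i

/-- `α! = α_1! ⋯ α_d!`. -/
def multiFactorial {d : ℕ} (α : Fin d → ℕ) : ℕ := ∏ i, (α i).factorial

/-- `x^β = x_1^{β_1} ⋯ x_d^{β_d}`. -/
def monomialAt {d : ℕ} (β : Fin d → ℕ) (x : RPt d) : ℝ := ∏ i, x i ^ β i

/-- The index set (pairs of multi-indices and a point) of the supremum in the norm of
`S_{s,h}(ℝ^d)`. -/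
abbrev GSIndex (d : ℕ) : Type := (Fin d → ℕ) × (Fin d → ℕ) × RPt d

/-- `h^{|α|+|β|} (α! β!)^s`. -/
def gsWeight {d : ℕ} (s h : ℝ) (α β : Fin d → ℕ) : ℝ :=
  h ^ (multiLength α + multiLength β) * ((multiFactorial α * multiFactorial β : ℕ) : ℝ) ^ s

/-- `|x^β ∂^α f(x)| / (h^{|α|+|β|} (α! β!)^s)`. -/
def gsTerm {d : ℕ} (s h : ℝ) (f : 𝓢(RPt d, ℂ)) (i : GSIndex d) : ℝ :=
  |monomialAt i.2.1 i.2.2| * ‖multiD i.1 f i.2.2‖ / gsWeight s h i.1 i.2.1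

lemma multiFactorial_pos {d : ℕ} (α : Fin d → ℕ) : 0 < multiFactorial α :=
  Finset.prod_pos fun i _ => Nat.factorial_pos (α i)

lemma gsWeight_pos {d : ℕ} (s : ℝ) {h : ℝ} (hh : 0 < h) (α β : Fin d → ℕ) :
    0 < gsWeight s h α β := by
  refine mul_pos (pow_pos hh _) (Real.rpow_pos_of_pos ?_ _)
  exact_mod_cast Nat.mul_pos (multiFactorial_pos α) (multiFactorial_pos β)

lemma gsTerm_nonneg {d : ℕ} (s : ℝ) {h : ℝ} (hh : 0 < h) (f : 𝓢(RPt d, ℂ)) (i : GSIndex d) :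
    0 ≤ gsTerm s h f i :=
  div_nonneg (mul_nonneg (abs_nonneg _) (norm_nonneg _)) (gsWeight_pos s hh _ _).le

lemma gsTerm_add_le {d : ℕ} (s : ℝ) {h : ℝ} (hh : 0 < h) (f g : 𝓢(RPt d, ℂ))
    (i : GSIndex d) : gsTerm s h (f + g) i ≤ gsTerm s h f i + gsTerm s h g i := by
  unfold gsTerm
  rw [← add_div, ← mul_add, map_add, add_apply]
  have := (gsWeight_pos s hh i.1 i.2.1).le
  gcongr
  exact norm_add_le _ _

lemma gsTerm_smul {d : ℕ} (s h : ℝ) (c : ℂ) (f : 𝓢(RPt d, ℂ)) (i : GSIndex d) :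
    gsTerm s h (c • f) i = ‖c‖ * gsTerm s h f i := by
  unfold gsTerm
  rw [map_smul, smul_apply, norm_smul]
  ring

lemma gsTerm_zero {d : ℕ} (s h : ℝ) (i : GSIndex d) :
    gsTerm s h (0 : 𝓢(RPt d, ℂ)) i = 0 := by
  simp [gsTerm]

lemma gsTerm_anti {d : ℕ} (s : ℝ) {h h' : ℝ} (hh : 0 < h) (hle : h ≤ h') (f : 𝓢(RPt d, ℂ))
    (i : GSIndex d) : gsTerm s h' f i ≤ gsTerm s h f i := by
  unfold gsTerm
  have hw : gsWeight s h i.1 i.2.1 ≤ gsWeight s h' i.1 i.2.1 := by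
    unfold gsWeight
    gcongr
  have := gsWeight_pos s hh i.1 i.2.1
  gcongr

/-! ### The Banach spaces `S_{s,h}` -/

/-- The functions of finite `S_{s,h}`-norm. (A smooth function with finite norm is automatically a
Schwartz function, so that nothing is lost by starting from Schwartz functions.) -/
def gsStepSubmodule (s : ℝ) (h : Set.Ioi (0 : ℝ)) (d : ℕ) : Submodule ℂ 𝓢(RPt d, ℂ) where
  carrier := {f | BddAbove (Set.range (gsTerm s h f))}
  zero_mem' := ⟨0, by rintro _ ⟨i, rfl⟩; exact (gsTerm_zero s h i).le⟩
  add_mem' := by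
    rintro f g ⟨A, hA⟩ ⟨B, hB⟩
    refine ⟨A + B, ?_⟩
    rintro _ ⟨i, rfl⟩
    exact (gsTerm_add_le s h.2 f g i).trans
      (add_le_add (hA (Set.mem_range_self i)) (hB (Set.mem_range_self i)))
  smul_mem' := by
    rintro c f ⟨A, hA⟩
    refine ⟨‖c‖ * A, ?_⟩
    rintro _ ⟨i, rfl⟩
    rw [gsTerm_smul]
    exact mul_le_mul_of_nonneg_left (hA (Set.mem_range_self i)) (norm_nonneg c)

/-- The Banach space `S_{s,h}(ℝ^d)`, `h > 0`. -/
def GSStep (s : ℝ) (h : Set.Ioi (0 : ℝ)) (d : ℕ) : Type := ↥(gsStepSubmodule s h d)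

instance (s : ℝ) (h : Set.Ioi (0 : ℝ)) (d : ℕ) : AddCommGroup (GSStep s h d) :=
  inferInstanceAs (AddCommGroup ↥(gsStepSubmodule s h d))

instance (s : ℝ) (h : Set.Ioi (0 : ℝ)) (d : ℕ) : Module ℂ (GSStep s h d) :=
  inferInstanceAs (Module ℂ ↥(gsStepSubmodule s h d))

/-- The norm `sup_{α,β,x} |x^β ∂^α f(x)| / (h^{|α|+|β|} (α! β!)^s)`. -/
instance (s : ℝ) (h : Set.Ioi (0 : ℝ)) (d : ℕ) : Norm (GSStep s h d) :=
  ⟨fun f => ⨆ i : GSIndex d, gsTerm s h f.1 i⟩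

lemma GSStep.norm_def {s : ℝ} {h : Set.Ioi (0 : ℝ)} {d : ℕ} (f : GSStep s h d) :
    ‖f‖ = ⨆ i : GSIndex d, gsTerm s h f.1 i := rfl

lemma multiD_zero {d : ℕ} (f : 𝓢(RPt d, ℂ)) : multiD (0 : Fin d → ℕ) f = f := by
  simp [multiD]

lemma GSStep.core (s : ℝ) (h : Set.Ioi (0 : ℝ)) (d : ℕ) : NormedSpace.Core ℂ (GSStep s h d) where
  norm_nonneg f := Real.iSup_nonneg fun i => gsTerm_nonneg s h.2 f.1 i
  norm_smul c f := by
    have : ∀ i, gsTerm s h (c • f : GSStep s h d).1 i = ‖c‖ * gsTerm s h f.1 i :=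
      fun i => gsTerm_smul s h c f.1 i
    simp only [GSStep.norm_def, this]
    exact (Real.mul_iSup_of_nonneg (norm_nonneg c) _).symm
  norm_triangle f g := by
    refine ciSup_le fun i => (gsTerm_add_le s h.2 f.1 g.1 i).trans ?_
    exact add_le_add (le_ciSup f.2 i) (le_ciSup g.2 i)
  norm_eq_zero_iff f := by
    constructor
    · intro hf
      refine Subtype.ext (SchwartzMap.ext fun x => ?_)
      have h1 : gsTerm s h f.1 (0, 0, x) ≤ 0 := (le_ciSup f.2 (0, 0, x)).trans hf.le
      have h2 : gsTerm s h f.1 (0, 0, x) = ‖f.1 x‖ := by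
        simp [gsTerm, multiD_zero, monomialAt, gsWeight, multiLength, multiFactorial]
      rw [h2] at h1
      exact norm_le_zero_iff.1 h1
    · rintro rfl
      have : ∀ i, gsTerm s h (0 : GSStep s h d).1 i = 0 := fun i => gsTerm_zero s h i
      simp [GSStep.norm_def, this]

instance (s : ℝ) (h : Set.Ioi (0 : ℝ)) (d : ℕ) : NormedAddCommGroup (GSStep s h d) :=
  NormedAddCommGroup.ofCore (GSStep.core s h d)

instance (s : ℝ) (h : Set.Ioi (0 : ℝ)) (d : ℕ) : NormedSpace ℂ (GSStep s h d) :=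
  NormedSpace.ofCore (GSStep.core s h d)

lemma gsStepSubmodule_mono (s : ℝ) (d : ℕ) {h h' : Set.Ioi (0 : ℝ)} (hle : h ≤ h') :
    gsStepSubmodule s h d ≤ gsStepSubmodule s h' d := by
  rintro f ⟨A, hA⟩
  refine ⟨A, ?_⟩
  rintro _ ⟨i, rfl⟩
  exact (gsTerm_anti s h.2 hle f i).trans (hA (Set.mem_range_self i))

/-! ### The Gelfand-Shilov space of Roumieu type, `S_s = ⋃_h S_{s,h}` -/

def gsSubmodule (s : ℝ) (d : ℕ) : Submodule ℂ 𝓢(RPt d, ℂ) where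
  carrier := {f | ∃ h : Set.Ioi (0 : ℝ), f ∈ gsStepSubmodule s h d}
  zero_mem' := ⟨⟨1, Set.mem_Ioi.2 one_pos⟩, Submodule.zero_mem _⟩
  add_mem' := by
    rintro f g ⟨h, hf⟩ ⟨h', hg⟩
    exact ⟨h ⊔ h', Submodule.add_mem _ (gsStepSubmodule_mono s d le_sup_left hf)
      (gsStepSubmodule_mono s d le_sup_right hg)⟩
  smul_mem' := by
    rintro c f ⟨h, hf⟩
    exact ⟨h, Submodule.smul_mem _ c hf⟩

/-- `S_s(ℝ^d)`. -/
def GS (s : ℝ) (d : ℕ) : Type := ↥(gsSubmodule s d)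

instance (s : ℝ) (d : ℕ) : AddCommGroup (GS s d) := inferInstanceAs (AddCommGroup ↥(gsSubmodule s d))

instance (s : ℝ) (d : ℕ) : Module ℂ (GS s d) := inferInstanceAs (Module ℂ ↥(gsSubmodule s d))

/-- An element of `S_s(ℝ^d)` as a Schwartz function. -/
def GS.toSchwartz {s : ℝ} {d : ℕ} (f : GS s d) : 𝓢(RPt d, ℂ) := f.1

/-- The inclusion `S_{s,h} → S_s`. -/
def GSStep.toGS {s : ℝ} {d : ℕ} (h : Set.Ioi (0 : ℝ)) (f : GSStep s h d) : GS s d := ⟨f.1, h, f.2⟩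

/-- The inductive limit topology: the strongest topology on `S_s` for which every inclusion
`S_{s,h} → S_s` is continuous. -/
instance (s : ℝ) (d : ℕ) : TopologicalSpace (GS s d) :=
  ⨆ h : Set.Ioi (0 : ℝ), TopologicalSpace.coinduced (GSStep.toGS h) inferInstance

/-! ### The Gelfand-Shilov space of Beurling type, `Σ_s = ⋂_h S_{s,h}` -/

/-- `Σ_s(ℝ^d)`. -/
def GSSigma (s : ℝ) (d : ℕ) : Type := ↥(⨅ h : Set.Ioi (0 : ℝ), gsStepSubmodule s h d)

instance (s : ℝ) (d : ℕ) : AddCommGroup (GSSigma s d) :=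
  inferInstanceAs (AddCommGroup ↥(⨅ h : Set.Ioi (0 : ℝ), gsStepSubmodule s h d))

instance (s : ℝ) (d : ℕ) : Module ℂ (GSSigma s d) :=
  inferInstanceAs (Module ℂ ↥(⨅ h : Set.Ioi (0 : ℝ), gsStepSubmodule s h d))

/-- An element of `Σ_s(ℝ^d)` as a Schwartz function. -/
def GSSigma.toSchwartz {s : ℝ} {d : ℕ} (f : GSSigma s d) : 𝓢(RPt d, ℂ) := f.1

/-- The inclusion `Σ_s → S_{s,h}`. -/
def GSSigma.toStep {s : ℝ} {d : ℕ} (h : Set.Ioi (0 : ℝ)) (f : GSSigma s d) : GSStep s h d :=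
  ⟨f.1, (Submodule.mem_iInf _).1 f.2 h⟩

/-- The projective limit topology, defined by the norms of all `S_{s,h}`, `h > 0`. -/
instance (s : ℝ) (d : ℕ) : TopologicalSpace (GSSigma s d) :=
  ⨅ h : Set.Ioi (0 : ℝ), TopologicalSpace.induced (GSSigma.toStep h) inferInstance

/-! ### Slices `K(x, ·)` of kernels -/

/-- The point `(x, y)` of `ℝ^{m+n}`. -/
def pairPt {m n : ℕ} (x : RPt m) (y : RPt n) : RPt (m + n) := WithLp.toLp 2 (Fin.append x y)

lemma pairPt_castAdd {m n : ℕ} (x : RPt m) (y : RPt n) (i : Fin m) :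
    pairPt x y (Fin.castAdd n i) = x i := by simp [pairPt]

lemma pairPt_natAdd {m n : ℕ} (x : RPt m) (y : RPt n) (i : Fin n) :
    pairPt x y (Fin.natAdd m i) = y i := by simp [pairPt]

/-- `y ↦ (0, y)` as a continuous linear map. -/
def inrCLM (m n : ℕ) : RPt n →L[ℝ] RPt (m + n) :=
  LinearMap.toContinuousLinearMap
    { toFun := fun y => pairPt 0 y
      map_add' := fun y z => by
        ext i; refine Fin.addCases (fun i => ?_) (fun i => ?_) i <;>
          simp [pairPt_castAdd, pairPt_natAdd]
      map_smul' := fun c y => by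
        ext i; refine Fin.addCases (fun i => ?_) (fun i => ?_) i <;>
          simp [pairPt_castAdd, pairPt_natAdd] }

lemma pairPt_eq {m n : ℕ} (x : RPt m) (y : RPt n) :
    pairPt x y = inrCLM m n y + pairPt x 0 := by
  ext i
  refine Fin.addCases (fun i => ?_) (fun i => ?_) i <;>
    simp [inrCLM, pairPt_castAdd, pairPt_natAdd]

lemma pairPt_sub {m n : ℕ} (x : RPt m) (y z : RPt n) :
    pairPt x y - pairPt x z = inrCLM m n (y - z) := by
  rw [pairPt_eq x y, pairPt_eq x z, map_sub]; abel

lemma norm_inrCLM {m n : ℕ} (y : RPt n) : ‖inrCLM m n y‖ = ‖y‖ := by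
  simp [EuclideanSpace.norm_eq, Fin.sum_univ_add, inrCLM, pairPt_castAdd, pairPt_natAdd]

lemma pairPt_temperate {m n : ℕ} (x : RPt m) :
    (fun y : RPt n => pairPt x y).HasTemperateGrowth := by
  have : (fun y : RPt n => pairPt x y) = fun y => inrCLM m n y + pairPt x 0 :=
    funext fun y => pairPt_eq x y
  rw [this]
  fun_prop

lemma pairPt_antilipschitz {m n : ℕ} (x : RPt m) :
    AntilipschitzWith 1 (fun y : RPt n => pairPt x y) :=
  AntilipschitzWith.of_le_mul_dist fun y z => by
    rw [dist_eq_norm, dist_eq_norm, pairPt_sub, norm_inrCLM]; simp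

/-- `K ↦ K(x, ·)` for Schwartz functions. -/
def sliceS {m n : ℕ} (x : RPt m) : 𝓢(RPt (m + n), ℂ) →L[ℂ] 𝓢(RPt n, ℂ) :=
  SchwartzMap.compCLMOfAntilipschitz ℂ (pairPt_temperate x) (pairPt_antilipschitz x)

@[simp] lemma sliceS_apply {m n : ℕ} (x : RPt m) (K : 𝓢(RPt (m + n), ℂ)) (y : RPt n) :
    sliceS x K y = K (pairPt x y) := rfl

lemma partialD_sliceS {m n : ℕ} (x : RPt m) (i : Fin n) (K : 𝓢(RPt (m + n), ℂ)) :
    partialD i (sliceS x K) = sliceS x (partialD (Fin.natAdd m i) K) := by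
  ext y
  have hK : HasFDerivAt K (fderiv ℝ K (pairPt x y)) (pairPt x y) := K.differentiableAt.hasFDerivAt
  have hp : HasFDerivAt (fun y : RPt n => pairPt x y) (inrCLM m n) y := by
    have : (fun y : RPt n => pairPt x y) = fun y => inrCLM m n y + pairPt x 0 :=
      funext fun y => pairPt_eq x y
    rw [this]
    exact (inrCLM m n).hasFDerivAt.add_const _
  have hc : fderiv ℝ (sliceS x K) y = (fderiv ℝ K (pairPt x y)).comp (inrCLM m n) :=
    (hK.comp y hp).fderiv
  have he : inrCLM m n (EuclideanSpace.single i (1 : ℝ))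
      = EuclideanSpace.single (Fin.natAdd m i) (1 : ℝ) := by
    ext j
    refine Fin.addCases (fun j => ?_) (fun j => ?_) j
    · have : Fin.castAdd n j ≠ Fin.natAdd m i := by
        intro h; have := congrArg Fin.val h; simp at this; omega
      simp [inrCLM, pairPt_castAdd, this]
    · simp [inrCLM, pairPt_natAdd, Fin.ext_iff]
  simp only [partialD, LineDeriv.lineDerivOpCLM_apply, sliceS_apply,
    SchwartzMap.lineDerivOp_apply_eq_fderiv, hc, ContinuousLinearMap.comp_apply, he]

/-- The multi-index `(0, β)`. -/
def padLeft {n : ℕ} (m : ℕ) (β : Fin n → ℕ) : Fin (m + n) → ℕ := Fin.append 0 β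

lemma partialD_pow_sliceS {m n : ℕ} (x : RPt m) (i : Fin n) (k : ℕ) (K : 𝓢(RPt (m + n), ℂ)) :
    (partialD i ^ k) (sliceS x K) = sliceS x ((partialD (Fin.natAdd m i) ^ k) K) := by
  induction k generalizing K with
  | zero => rfl
  | succ k ih =>
    rw [pow_succ, pow_succ, mul_apply_eq_comp, mul_apply_eq_comp,
      partialD_sliceS, ih]

lemma multiD_sliceS {m n : ℕ} (x : RPt m) (β : Fin n → ℕ) (K : 𝓢(RPt (m + n), ℂ)) :
    multiD β (sliceS x K) = sliceS x (multiD (padLeft m β) K) := by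
  have h1 : multiD (padLeft m β)
      = ((List.finRange n).map fun i => partialD (Fin.natAdd m i) ^ β i).prod := by
    unfold multiD
    rw [← List.ofFn_eq_map, List.ofFn_add, List.prod_append, ← List.ofFn_eq_map]
    have : (List.ofFn fun i : Fin m => partialD (Fin.castAdd n i) ^
        padLeft m β (Fin.castAdd n i)).prod = 1 := by
      simp [padLeft]
    refine (congrArg₂ (· * ·) this ?_).trans (one_mul _)
    simp [padLeft]
  rw [h1]
  unfold multiD
  induction List.finRange n with
  | nil => rfl
  | cons a l ih =>
    simp only [List.map_cons, List.prod_cons, mul_apply_eq_comp, ih,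
      partialD_pow_sliceS]

lemma gsTerm_sliceS {m n : ℕ} (s h : ℝ) (x : RPt m) (K : 𝓢(RPt (m + n), ℂ)) (i : GSIndex n) :
    gsTerm s h (sliceS x K) i
      = gsTerm s h K (padLeft m i.1, padLeft m i.2.1, pairPt x i.2.2) := by
  have hL : ∀ β : Fin n → ℕ, multiLength (padLeft m β) = multiLength β := fun β => by
    simp [multiLength, padLeft, Fin.sum_univ_add]
  have hF : ∀ β : Fin n → ℕ, multiFactorial (padLeft m β) = multiFactorial β := fun β => by
    simp [multiFactorial, padLeft, Fin.prod_univ_add]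
  have hM : monomialAt (padLeft m i.2.1) (pairPt x i.2.2) = monomialAt i.2.1 i.2.2 := by
    simp [monomialAt, padLeft, Fin.prod_univ_add, pairPt_castAdd, pairPt_natAdd]
  simp only [gsTerm, multiD_sliceS, sliceS_apply, gsWeight, hL, hF, hM]

lemma sliceS_mem {m n : ℕ} (s : ℝ) (h : Set.Ioi (0 : ℝ)) (x : RPt m) {K : 𝓢(RPt (m + n), ℂ)}
    (hK : K ∈ gsStepSubmodule s h (m + n)) : sliceS x K ∈ gsStepSubmodule s h n := by
  obtain ⟨A, hA⟩ := hK
  refine ⟨A, ?_⟩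
  rintro _ ⟨i, rfl⟩
  rw [gsTerm_sliceS]
  exact hA (Set.mem_range_self _)

/-- `K(x, ·) ∈ S_s(ℝ^n)` for `K ∈ S_s(ℝ^{m+n})`. -/
def GS.slice {s : ℝ} {m n : ℕ} (K : GS s (m + n)) (x : RPt m) : GS s n :=
  ⟨sliceS x K.1, K.2.imp fun h hK => sliceS_mem s h x hK⟩

/-- `K(x, ·) ∈ Σ_s(ℝ^n)` for `K ∈ Σ_s(ℝ^{m+n})`. -/
def GSSigma.slice {s : ℝ} {m n : ℕ} (K : GSSigma s (m + n)) (x : RPt m) : GSSigma s n :=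
  ⟨sliceS x K.1, (Submodule.mem_iInf _).2 fun h =>
    sliceS_mem s h x ((Submodule.mem_iInf _).1 K.2 h)⟩

/-! ### Quasi-Banach spaces -/

/-- A complex quasi-Banach space: a vector space with a quasi-norm, with the topology defined by
the quasi-norm, which is complete. -/
class QuasiBanachSpace (B : Type*) [AddCommGroup B] [Module ℂ B] extends
    Norm B, TopologicalSpace B where
  norm_nonneg' : ∀ f : B, 0 ≤ ‖f‖
  norm_eq_zero_iff' : ∀ f : B, ‖f‖ = 0 ↔ f = 0
  norm_smul' : ∀ (c : ℂ) (f : B), ‖c • f‖ = ‖c‖ * ‖f‖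
  exists_quasi_triangle : ∃ D : ℝ, 1 ≤ D ∧ ∀ f g : B, ‖f + g‖ ≤ D * (‖f‖ + ‖g‖)
  isOpen_iff_ball : ∀ U : Set B,
    IsOpen U ↔ ∀ f ∈ U, ∃ ε > (0 : ℝ), ∀ g : B, ‖g - f‖ < ε → g ∈ U
  complete : ∀ u : ℕ → B,
    (∀ ε > (0 : ℝ), ∃ N : ℕ, ∀ m ≥ N, ∀ n ≥ N, ‖u m - u n‖ < ε) →
    ∃ f : B, ∀ ε > (0 : ℝ), ∃ N : ℕ, ∀ n ≥ N, ‖u n - f‖ < ε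

/-! ### Singular values and Schatten-von Neumann classes -/

section Schatten

variable {B₁ B₂ : Type*} [AddCommGroup B₁] [Module ℂ B₁] [QuasiBanachSpace B₁]
  [AddCommGroup B₂] [Module ℂ B₂] [QuasiBanachSpace B₂]

/-- The operator quasi-norm `‖T‖_{B₁ → B₂} ∈ [0, ∞]` of a linear map. -/
def opNorm (T : B₁ →ₗ[ℂ] B₂) : ℝ≥0∞ := ⨆ f : B₁, ⨆ _ : ‖f‖ ≤ 1, ENNReal.ofReal ‖T f‖

/-- The singular value (approximation number) of order `j ≥ 1`: the infimum of `‖T - T₀‖` over all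
linear `T₀` of rank at most `j - 1`. -/
def singularValue (j : ℕ) (T : B₁ →ₗ[ℂ] B₂) : ℝ≥0∞ :=
  ⨅ T₀ : B₁ →ₗ[ℂ] B₂, ⨅ _ : T₀.rank < (j : Cardinal), opNorm (T - T₀)

/-- `‖T‖_{I_p}`, the `ℓ^p` quasi-norm of `(σ_j(T))_{j ≥ 1}`, for `p ∈ (0, ∞]`. -/
def schattenNorm (p : ℝ≥0∞) (T : B₁ →ₗ[ℂ] B₂) : ℝ≥0∞ :=
  if p = ∞ then ⨆ j : ℕ, singularValue (j + 1) T
  else (∑' j : ℕ, singularValue (j + 1) T ^ p.toReal) ^ (1 / p.toReal)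

/-- `T ∈ I_p(B₁, B₂)`. -/
def MemSchatten (p : ℝ≥0∞) (T : B₁ →ₗ[ℂ] B₂) : Prop := schattenNorm p T < ∞

end Schatten

/-! ### Embeddings into and out of spaces of distributions

Distributions act on test functions through the bilinear pairing `⟨f, φ⟩ = (f, φ̄)_{L²}`, and all
dual spaces carry the strong dual topology. -/

/-- The ambient distribution space `S_{1/2}'(ℝ^d)`. -/
abbrev GSHalfDual (d : ℕ) : Type := StrongDual ℂ (GS (1 / 2) d)

/-- The distribution `u` is the function `φ`. -/
def IsFunction {d : ℕ} (u : GSHalfDual d) (φ : 𝓢(RPt d, ℂ)) : Prop :=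
  ∀ g : GS (1 / 2) d, u g = ∫ x, φ x * g.toSchwartz x

/-- `S_{1/2}(ℝ^d) ↪ B ↪ S_{1/2}'(ℝ^d)`, where `ι` is the inclusion of `B` in `S_{1/2}'(ℝ^d)`. -/
structure IsIntermediate {d : ℕ} {B : Type*} [AddCommGroup B] [Module ℂ B] [QuasiBanachSpace B]
    (ι : B →ₗ[ℂ] GSHalfDual d) : Prop where
  injective : Function.Injective ι
  continuous : Continuous ι
  exists_incl : ∃ k : GS (1 / 2) d →ₗ[ℂ] B, Continuous k ∧ ∀ φ, IsFunction (ι (k φ)) φ.toSchwartz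

/-- `j` is a continuous inclusion `B ↪ X'`, where `B ⊆ S_{1/2}'(ℝ^d)` by means of `ι`, and where
`X` is a space of test functions that contains `S_{1/2}(ℝ^d)`: the functional `j f` on `X` agrees
with `f` on `S_{1/2}(ℝ^d)`. -/
structure IsInclToDual {d : ℕ} {B : Type*} [AddCommGroup B] [Module ℂ B] [QuasiBanachSpace B]
    (ι : B →ₗ[ℂ] GSHalfDual d) {X : Type*} [AddCommGroup X] [Module ℂ X] [TopologicalSpace X]
    (toS : X → 𝓢(RPt d, ℂ)) (j : B →ₗ[ℂ] StrongDual ℂ X) : Prop where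
  continuous : Continuous j
  compat : ∀ (f : B) (φ : GS (1 / 2) d) (ψ : X), toS ψ = φ.toSchwartz → j f ψ = ι f φ

/-- `k` is a continuous inclusion `X ↪ B`, where `B ⊆ S_{1/2}'(ℝ^d)` by means of `ι`. -/
structure IsInclFromTest {d : ℕ} {B : Type*} [AddCommGroup B] [Module ℂ B] [QuasiBanachSpace B]
    (ι : B →ₗ[ℂ] GSHalfDual d) {X : Type*} [AddCommGroup X] [Module ℂ X] [TopologicalSpace X]
    (toS : X → 𝓢(RPt d, ℂ)) (k : X →ₗ[ℂ] B) : Prop where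
  continuous : Continuous k
  compat : ∀ φ : X, IsFunction (ι (k φ)) (toS φ)

/-- `T : B₁ → B₂` is the operator `T_K` with kernel `K`. For `f ∈ B₁ ⊆ X₁'`, the distribution
`T_K f` is the function `x ↦ ⟨f, K(x, ·)⟩` (the integral of `K(x, y) f(y)` over `y`), which
belongs to `X₂ ⊆ B₂`. Here `j` and `k` are the inclusions of `B₁` in `X₁'` and of `X₂` in `B₂`,
and `slice x` is `K(x, ·)`. -/
def IsKernelOperator {d : ℕ} {B₁ B₂ X₁ X₂ : Type*} [AddCommGroup B₁] [Module ℂ B₁]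
    [AddCommGroup B₂] [Module ℂ B₂] [AddCommGroup X₁] [Module ℂ X₁] [TopologicalSpace X₁]
    [AddCommGroup X₂] [Module ℂ X₂] (toS : X₂ → 𝓢(RPt d, ℂ))
    (j : B₁ →ₗ[ℂ] StrongDual ℂ X₁) (k : X₂ →ₗ[ℂ] B₂) (slice : RPt d → X₁)
    (T : B₁ →ₗ[ℂ] B₂) : Prop :=
  ∀ f : B₁, ∃ φ : X₂, (∀ x, toS φ x = j f (slice x)) ∧ T f = k φ

end GSKernel

end

noncomputable section

namespace GSKernel

open Filter Topology

/-! Let `Φ f` be the function `x ↦ ⟨f, K(x, ·)⟩`, so that `T_K = k ∘ Φ`. The slices of `K` and of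
its `x`-derivatives, multiplied by the weights of the target space, form bounded sets of test
functions. Continuity of `j` into the strong dual therefore bounds each of the relevant weighted
suprema of `|x^β ∂^α (Φ f)(x)|` by a multiple of `‖f‖` (`exists_kernelTransform`). Continuity of `k`
in turn bounds `‖k φ‖` by a single weighted supremum of `φ`.

Between these two estimates there is room for a chain of weights `V 0, …, V q` of any length, each
dominated by the one before. Suppose that the derivatives `∂^α φ` with all `α_i ≤ N` vanish on the
grid of mesh `1/N` in `[-N, N]^d`. Then every link of the chain gains a factor of order `1/N`: the
weight itself pays for high derivatives and for distant points, and elsewhere the mean value theorem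
is applied from a nearby grid point (`WeightBound.of_vanishing`). So the supremum with weight `V q`
is at most `C N^{-q}` times the one with weight `V 0`.

This vanishing amounts to at most `(N+1)^d (2N²+1)^d` linear conditions on `f`. An approximate
Auerbach basis provides a map of rank `n`, with `n` at most this number, that reproduces all samples
and whose error grows at most by the factor `1 + 2n` (`exists_finiteRank_interpolation`). Hence
`σ_{n+1} ≤ C (1 + 2n) N^{-q}`, where `n` is polynomial in `N` of a degree independent of `q`. Since
`q` is arbitrary, the singular values decrease faster than every power of `j`, and they lie in every
`ℓ^p`.

No convexity of `B₁` or `B₂` is needed: the linear algebra uses a seminorm pulled back from the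
weights, and the quasi-norm of `B₂` is only evaluated on single vectors. The three cases differ only
in their chains: `h` is doubled upwards from that of the kernel (Roumieu), doubled up to the one
that controls `k` (Beurling), or the admitted length of multi-indices is lowered step by step
(Schwartz). -/

/-! ### Multi-indices and partial derivatives -/

/-- The unit multi-index `e_i`. -/
abbrev unitIndex {d : ℕ} (i : Fin d) : Fin d → ℕ := Pi.single i 1

lemma multiIndex_induction {d : ℕ} {P : (Fin d → ℕ) → Prop} (h0 : P 0)
    (h1 : ∀ α i, P α → P (α + unitIndex i)) (α : Fin d → ℕ) : P α := by
  obtain ⟨n, hn⟩ : ∃ n, ∑ i, α i = n := ⟨_, rfl⟩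
  induction n generalizing α with
  | zero =>
    have : α = 0 := by
      ext i
      exact (Finset.sum_eq_zero_iff.1 hn) i (Finset.mem_univ i)
    rwa [this]
  | succ n ih =>
    obtain ⟨i, hi⟩ : ∃ i, α i ≠ 0 := by
      by_contra! h
      simp [h] at hn
    have hα : α = (α - unitIndex i) + unitIndex i := by
      ext j
      by_cases hj : j = i
      · subst hj; simp; omega
      · simp [Pi.single_eq_of_ne hj]
    rw [hα]
    apply h1
    apply ih
    rw [hα] at hn
    simp only [Pi.add_apply, Finset.sum_add_distrib, Finset.sum_pi_single', Finset.mem_univ,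
      if_true] at hn
    omega

lemma multiLength_add {d : ℕ} (α β : Fin d → ℕ) :
    multiLength (α + β) = multiLength α + multiLength β := by
  simp [multiLength, Finset.sum_add_distrib]

lemma multiLength_unitIndex {d : ℕ} (i : Fin d) : multiLength (unitIndex i) = 1 := by
  simp [multiLength]

lemma le_multiLength {d : ℕ} (α : Fin d → ℕ) (i : Fin d) : α i ≤ multiLength α :=
  Finset.single_le_sum (f := α) (fun _ _ => Nat.zero_le _) (Finset.mem_univ i)

lemma partialD_apply {d : ℕ} (i : Fin d) (f : 𝓢(RPt d, ℂ)) (x : RPt d) :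
    partialD i f x = fderiv ℝ f x (EuclideanSpace.single i (1 : ℝ)) := by
  simp [partialD, LineDeriv.lineDerivOpCLM_apply, SchwartzMap.lineDerivOp_apply_eq_fderiv]

lemma partialD_commute {d : ℕ} (i j : Fin d) : Commute (partialD i) (partialD j) := by
  ext f x
  have hd : ∀ a b : Fin d, partialD a (partialD b f) x
      = fderiv ℝ (fderiv ℝ f) x (EuclideanSpace.single a (1 : ℝ))
        (EuclideanSpace.single b (1 : ℝ)) := by
    intro a b
    rw [partialD_apply]
    have h1 : (partialD b f : RPt d → ℂ)
        = fun y => fderiv ℝ f y (EuclideanSpace.single b (1 : ℝ)) := by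
      ext y; exact partialD_apply b f y
    have h2 : DifferentiableAt ℝ (fderiv ℝ f) x :=
      ((f.smooth 2).fderiv_right (m := 1) (by norm_num)).differentiable (by norm_num) x
    rw [h1, fderiv_clm_apply h2 (differentiableAt_const _)]
    simp
  change partialD i (partialD j f) x = partialD j (partialD i f) x
  rw [hd, hd]
  have hs : IsSymmSndFDerivAt ℝ f x :=
    ((f.smooth 2).contDiffAt).isSymmSndFDerivAt (by simp)
  exact hs _ _

/-- The product defining `multiD` is ordered, so merging exponents relies on the symmetry of second
derivatives, `partialD_commute`. -/
lemma multiD_add {d : ℕ} (α β : Fin d → ℕ) : multiD (α + β) = multiD α * multiD β := by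
  unfold multiD
  have hc : ∀ (i : Fin d) (n : ℕ) (l : List (Fin d)),
      Commute (partialD i ^ n) ((l.map fun i => partialD i ^ α i).prod) := by
    intro i n l
    induction l with
    | nil => simp
    | cons a l ih =>
      rw [List.map_cons, List.prod_cons]
      exact (((partialD_commute i a).pow_pow _ _)).mul_right ih
  induction List.finRange d with
  | nil => simp
  | cons a l ih =>
    rw [List.map_cons, List.prod_cons, ih, Pi.add_apply, pow_add]
    simp only [List.map_cons, List.prod_cons]
    have := hc a (β a) l
    simp only [mul_assoc]
    rw [← mul_assoc (partialD a ^ β a) (List.prod _), this.eq, mul_assoc]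

lemma multiD_unitIndex {d : ℕ} (i : Fin d) : multiD (unitIndex i) = partialD i := by
  unfold multiD
  have h : ∀ l : List (Fin d), l.Nodup →
      (l.map fun j => partialD j ^ (unitIndex i : Fin d → ℕ) j).prod
        = if i ∈ l then partialD i else 1 := by
    intro l hl
    induction l with
    | nil => simp
    | cons a l ih =>
      rw [List.nodup_cons] at hl
      rw [List.map_cons, List.prod_cons, ih hl.2]
      by_cases ha : a = i
      · subst ha; simp [hl.1]
      · simp [Ne.symm ha, ha]
  rw [h _ (List.nodup_finRange d)]
  simp

lemma multiD_add_unitIndex {d : ℕ} (α : Fin d → ℕ) (i : Fin d) (f : 𝓢(RPt d, ℂ)) :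
    multiD (α + unitIndex i) f = partialD i (multiD α f) := by
  rw [add_comm, multiD_add, multiD_unitIndex]; rfl

lemma multiD_add_apply {d : ℕ} (α β : Fin d → ℕ) (f : 𝓢(RPt d, ℂ)) :
    multiD (α + β) f = multiD α (multiD β f) := by
  rw [multiD_add]; rfl

/-! ### Families of functions closed under partial derivatives -/

/-- The real linear map `z ↦ ∑ i, z_i c_i`. -/
def gradCLM {d : ℕ} (c : Fin d → ℂ) : RPt d →L[ℝ] ℂ :=
  ∑ i, (EuclideanSpace.proj i : RPt d →L[ℝ] ℝ).smulRight (c i)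

lemma gradCLM_apply {d : ℕ} (c : Fin d → ℂ) (z : RPt d) :
    gradCLM c z = ∑ i, (z i : ℂ) * c i := by
  simp [gradCLM]

lemma gradCLM_single {d : ℕ} (c : Fin d → ℂ) (i : Fin d) :
    gradCLM c (EuclideanSpace.single i (1 : ℝ)) = c i := by
  rw [gradCLM_apply, Finset.sum_eq_single i]
  · simp
  · intro b _ hb; simp [hb]
  · simp

lemma norm_proj_le {d : ℕ} (i : Fin d) :
    ‖(EuclideanSpace.proj i : RPt d →L[ℝ] ℝ)‖ ≤ 1 :=
  ContinuousLinearMap.opNorm_le_bound _ zero_le_one fun x => by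
    simpa using PiLp.norm_apply_le x i

lemma norm_gradCLM_le {d : ℕ} (c : Fin d → ℂ) : ‖gradCLM c‖ ≤ ∑ i, ‖c i‖ := by
  refine (norm_sum_le _ _).trans (Finset.sum_le_sum fun i _ => ?_)
  rw [ContinuousLinearMap.norm_smulRight_apply]
  exact mul_le_of_le_one_left (norm_nonneg _) (norm_proj_le i)

lemma gradCLM_sub {d : ℕ} (b c : Fin d → ℂ) :
    gradCLM b - gradCLM c = gradCLM fun i => b i - c i := by
  ext z; simp [gradCLM_apply, mul_sub]

lemma eq_gradCLM {d : ℕ} (L : RPt d →L[ℝ] ℂ) :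
    L = gradCLM fun i => L (EuclideanSpace.single i (1 : ℝ)) := by
  have : L.toLinearMap = (gradCLM fun i => L (EuclideanSpace.single i (1 : ℝ))).toLinearMap := by
    refine (EuclideanSpace.basisFun (Fin d) ℝ).toBasis.ext fun i => ?_
    simp [gradCLM_single]
  exact ContinuousLinearMap.coe_injective this

/-- A family of functions indexed by multi-indices in which `G (α + e_i)` is the partial derivative
`∂_i (G α)`. -/
def IsDerivFamily {d : ℕ} (G : (Fin d → ℕ) → RPt d → ℂ) : Prop :=
  ∀ α x, HasFDerivAt (G α) (gradCLM fun i => G (α + unitIndex i) x) x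

lemma isDerivFamily_multiD {d : ℕ} (f : 𝓢(RPt d, ℂ)) :
    IsDerivFamily fun α => (multiD α f : RPt d → ℂ) := by
  intro α x
  have h := (multiD α f).differentiableAt (x := x) |>.hasFDerivAt
  rw [eq_gradCLM (fderiv ℝ (multiD α f) x)] at h
  simpa only [multiD_add_unitIndex, partialD_apply] using h

namespace IsDerivFamily

variable {d : ℕ} {G : (Fin d → ℕ) → RPt d → ℂ}

lemma contDiff_nat (hG : IsDerivFamily G) (n : ℕ) (α : Fin d → ℕ) : ContDiff ℝ n (G α) := by
  induction n generalizing α with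
  | zero =>
    exact contDiff_zero.2 (continuous_iff_continuousAt.2 fun x => (hG α x).continuousAt)
  | succ n ih =>
    push_cast
    refine contDiff_succ_iff_hasFDerivAt.2 ⟨_, ?_, hG α⟩
    exact ContDiff.sum fun i _ => contDiff_const.smulRight (ih _)

lemma contDiff (hG : IsDerivFamily G) (α : Fin d → ℕ) : ContDiff ℝ (⊤ : ℕ∞) (G α) :=
  contDiff_infty.2 fun n => hG.contDiff_nat n α

/-- Each differentiation is a sum over the `d` coordinates of partial derivatives composed with
linear maps of norm at most one; this produces one factor `d` per order. -/
lemma norm_iteratedFDeriv_le (hG : IsDerivFamily G) (n : ℕ) (α : Fin d → ℕ) {x : RPt d} {A : ℝ}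
    (hA : ∀ γ, multiLength γ = n → ‖G (α + γ) x‖ ≤ A) :
    ‖iteratedFDeriv ℝ n (G α) x‖ ≤ (d : ℝ) ^ n * A := by
  induction n generalizing α with
  | zero => simpa [multiLength] using hA 0 (by simp [multiLength])
  | succ n ih =>
    rw [← norm_iteratedFDeriv_fderiv]
    have hf : fderiv ℝ (G α) = ∑ i : Fin d, fun x =>
        (ContinuousLinearMap.smulRightL ℝ (RPt d) ℂ (EuclideanSpace.proj i : RPt d →L[ℝ] ℝ))
          (G (α + unitIndex i) x) := by
      ext1 x; rw [(hG α x).fderiv, Finset.sum_apply]; rfl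
    rw [hf, iteratedFDeriv_sum_apply]
    · refine (norm_sum_le _ _).trans ?_
      have : ∀ i : Fin d, ‖iteratedFDeriv ℝ n (fun x =>
          (ContinuousLinearMap.smulRightL ℝ (RPt d) ℂ (EuclideanSpace.proj i : RPt d →L[ℝ] ℝ))
            (G (α + unitIndex i) x)) x‖ ≤ (d : ℝ) ^ n * A := by
        intro i
        have h1 := ContinuousLinearMap.norm_iteratedFDeriv_comp_left
          (ContinuousLinearMap.smulRightL ℝ (RPt d) ℂ (EuclideanSpace.proj i : RPt d →L[ℝ] ℝ))
          (hG.contDiff_nat n (α + unitIndex i)).contDiffAt (x := x) (n := n) le_rfl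
        refine h1.trans ((mul_le_of_le_one_left (norm_nonneg _) ?_).trans ?_)
        · refine ContinuousLinearMap.opNorm_le_bound _ zero_le_one fun c => ?_
          rw [ContinuousLinearMap.smulRightL_apply_apply,
            ContinuousLinearMap.norm_smulRight_apply]
          exact mul_le_mul_of_nonneg_right (norm_proj_le i) (norm_nonneg _)
        · refine ih _ fun γ hγ => ?_
          rw [add_assoc]
          exact hA _ (by rw [multiLength_add, multiLength_unitIndex, hγ, add_comm])
      refine (Finset.sum_le_sum fun i _ => this i).trans ?_
      simp [pow_succ]; ring_nf; rfl
    · intro i _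
      exact ((ContinuousLinearMap.contDiff _).comp (hG.contDiff_nat n _)).contDiffAt

lemma norm_sub_le (hG : IsDerivFamily G) (α : Fin d → ℕ) {M : ℝ}
    (hM : ∀ i x, ‖G (α + unitIndex i) x‖ ≤ M) (x y : RPt d) :
    ‖G α y - G α x‖ ≤ d * M * ‖y - x‖ := by
  refine Convex.norm_image_sub_le_of_norm_hasFDerivWithin_le (s := Set.univ)
    (fun z _ => (hG α z).hasFDerivWithinAt) (fun z _ => ?_) convex_univ trivial trivial
  refine (norm_gradCLM_le _).trans ((Finset.sum_le_sum fun i _ => hM i z).trans ?_)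
  simp

/-- The mean value inequality is applied to `G α` minus its linear part on the ball of radius `‖z‖`,
where the gradient varies by at most `d * (d * M * ‖z‖)` according to `norm_sub_le`. -/
lemma norm_taylor_le (hG : IsDerivFamily G) (α : Fin d → ℕ) {M : ℝ}
    (hM : ∀ i j x, ‖G (α + unitIndex i + unitIndex j) x‖ ≤ M) (x z : RPt d) :
    ‖G α (x + z) - G α x - ∑ i, (z i : ℂ) * G (α + unitIndex i) x‖
      ≤ d ^ 2 * M * ‖z‖ ^ 2 := by
  have h1 := Convex.norm_image_sub_le_of_norm_hasFDerivWithin_le' (f := G α)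
    (s := Metric.closedBall x ‖z‖) (φ := gradCLM fun i => G (α + unitIndex i) x)
    (C := d * (d * M * ‖z‖)) (x := x) (y := x + z)
    (fun y _ => (hG α y).hasFDerivWithinAt) (fun y hy => ?_) (convex_closedBall _ _)
    (by simp) (by simp)
  · rw [gradCLM_apply] at h1
    simp only [add_sub_cancel_left] at h1
    refine h1.trans (le_of_eq (by ring))
  · rw [gradCLM_sub]
    refine (norm_gradCLM_le _).trans ?_
    have : ∀ i ∈ Finset.univ, ‖G (α + unitIndex i) y - G (α + unitIndex i) x‖ ≤ d * M * ‖z‖ := by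
      intro i _
      refine (hG.norm_sub_le _ (fun j x => hM i j x) x y).trans ?_
      have hM0 : 0 ≤ M := (norm_nonneg _).trans (hM i i x)
      have : ‖y - x‖ ≤ ‖z‖ := by simpa [dist_eq_norm] using hy
      gcongr
    refine (Finset.sum_le_sum this).trans ?_
    simp

end IsDerivFamily

/-! ### Construction of Schwartz functions from families of partial derivatives -/

lemma monomialAt_add {d : ℕ} (β γ : Fin d → ℕ) (x : RPt d) :
    monomialAt (β + γ) x = monomialAt β x * monomialAt γ x := by
  simp [monomialAt, pow_add, Finset.prod_mul_distrib]

lemma monomialAt_unitIndex {d : ℕ} (i : Fin d) (x : RPt d) :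
    monomialAt (unitIndex i) x = x i := by
  unfold monomialAt
  rw [Finset.prod_eq_single i]
  · simp
  · intro j _ hj; simp [hj]
  · simp

lemma monomialAt_zero {d : ℕ} (x : RPt d) : monomialAt 0 x = 1 := by simp [monomialAt]

lemma norm_le_sum_abs {d : ℕ} (x : RPt d) : ‖x‖ ≤ ∑ i, |x i| := by
  rw [EuclideanSpace.norm_eq]
  refine Real.sqrt_le_iff.2 ⟨Finset.sum_nonneg fun _ _ => abs_nonneg _, ?_⟩
  exact Finset.sum_sq_le_sq_sum_of_nonneg fun i _ => norm_nonneg _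

lemma abs_monomialAt_le {d : ℕ} (β : Fin d → ℕ) (x : RPt d) :
    |monomialAt β x| ≤ ‖x‖ ^ multiLength β := by
  rw [monomialAt, Finset.abs_prod, multiLength, ← Finset.prod_pow_eq_pow_sum]
  refine Finset.prod_le_prod (fun _ _ => abs_nonneg _) fun i _ => ?_
  rw [abs_pow]
  exact pow_le_pow_left₀ (abs_nonneg _) (PiLp.norm_apply_le x i) _

/-- A power of the largest coordinate suffices, since `‖x‖ ≤ d |x_i|` for it. Only `multiLength β ≤
k` is asked, because for `d = 0` no multi-index has positive length. -/
lemma exists_monomialAt_ge {d : ℕ} (k : ℕ) (x : RPt d) :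
    ∃ β : Fin d → ℕ, multiLength β ≤ k ∧ ‖x‖ ^ k ≤ (d : ℝ) ^ k * |monomialAt β x| := by
  rcases Nat.eq_zero_or_pos k with rfl | hk
  · exact ⟨0, by simp [multiLength], by simp [monomialAt_zero]⟩
  rcases Nat.eq_zero_or_pos d with rfl | hd
  · refine ⟨0, by simp [multiLength], ?_⟩
    have : x = 0 := Subsingleton.elim _ _
    simp [this, hk.ne']
  have : Nonempty (Fin d) := ⟨⟨0, hd⟩⟩
  obtain ⟨i, hi⟩ := Finite.exists_max fun i => |x i|
  refine ⟨k • unitIndex i, ?_, ?_⟩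
  · simp only [multiLength, Pi.smul_apply, smul_eq_mul, ← Finset.mul_sum]
    simp
  · have h1 : monomialAt (k • unitIndex i) x = x i ^ k := by
      unfold monomialAt
      rw [Finset.prod_eq_single i]
      · simp
      · intro j _ hj; simp [hj]
      · simp
    rw [h1, abs_pow, ← mul_pow]
    refine pow_le_pow_left₀ (norm_nonneg _) ((norm_le_sum_abs x).trans ?_) _
    exact (Finset.sum_le_sum fun j _ => hi j).trans (by simp)

namespace IsDerivFamily

variable {d : ℕ} {G : (Fin d → ℕ) → RPt d → ℂ}

/-- Translates bounds by monomials and partial derivatives into the form of the Schwartz seminorms.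
The monomial depends on `x`, so the hypothesis has to cover all `β` of length at most `k`. -/
lemma norm_pow_mul_iteratedFDeriv_le (hG : IsDerivFamily G) (k n : ℕ) (α : Fin d → ℕ) {A : ℝ}
    (hA0 : 0 ≤ A) (x : RPt d)
    (hA : ∀ γ β, multiLength γ = n → multiLength β ≤ k →
      |monomialAt β x| * ‖G (α + γ) x‖ ≤ A) :
    ‖x‖ ^ k * ‖iteratedFDeriv ℝ n (G α) x‖ ≤ (d : ℝ) ^ k * ((d : ℝ) ^ n * A) := by
  obtain ⟨β, hβ, hx⟩ := exists_monomialAt_ge k x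
  refine (mul_le_mul_of_nonneg_right hx (norm_nonneg _)).trans ?_
  rw [mul_assoc]
  refine mul_le_mul_of_nonneg_left ?_ (by positivity)
  rcases (abs_nonneg (monomialAt β x)).eq_or_lt' with h0 | h0
  · rw [h0, zero_mul]; positivity
  · have := hG.norm_iteratedFDeriv_le n α (x := x) (A := A / |monomialAt β x|) fun γ hγ => by
      rw [le_div_iff₀' h0]; exact hA γ β hγ hβ
    calc _ ≤ |monomialAt β x| * ((d : ℝ) ^ n * (A / |monomialAt β x|)) :=
          mul_le_mul_of_nonneg_left this h0.le
      _ = _ := by field_simp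

end IsDerivFamily

/-- Multi-indices of bounded length lie in a finite box, so the individual constants can be added.
-/
lemma exists_uniform_bound {d : ℕ} {ι : Type*} {t : (Fin d → ℕ) → (Fin d → ℕ) → ι → ℝ}
    (ht : ∀ α β, ∃ C, ∀ x, t α β x ≤ C) (n k : ℕ) :
    ∃ A, 0 ≤ A ∧ ∀ α β, multiLength α ≤ n → multiLength β ≤ k → ∀ x, t α β x ≤ A := by
  choose C hC using ht
  refine ⟨∑ α ∈ Finset.Icc (0 : Fin d → ℕ) (fun _ => n),
    ∑ β ∈ Finset.Icc (0 : Fin d → ℕ) (fun _ => k), |C α β|, by positivity, ?_⟩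
  intro α β hα hβ x
  have hmα : α ∈ Finset.Icc (0 : Fin d → ℕ) (fun _ => n) :=
    Finset.mem_Icc.2 ⟨fun i => Nat.zero_le _, fun i => (le_multiLength α i).trans hα⟩
  have hmβ : β ∈ Finset.Icc (0 : Fin d → ℕ) (fun _ => k) :=
    Finset.mem_Icc.2 ⟨fun i => Nat.zero_le _, fun i => (le_multiLength β i).trans hβ⟩
  refine (hC α β x).trans ((le_abs_self _).trans ?_)
  refine (Finset.single_le_sum (f := fun β => |C α β|) (fun _ _ => abs_nonneg _) hmβ).trans ?_
  exact Finset.single_le_sum (f := fun α => ∑ β ∈ Finset.Icc (0 : Fin d → ℕ) (fun _ => k),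
    |C α β|) (fun _ _ => by positivity) hmα

/-- A family closed under partial derivatives, all of whose members are rapidly decreasing, consists
of the partial derivatives of a Schwartz function. -/
lemma IsDerivFamily.exists_schwartz {d : ℕ} {G : (Fin d → ℕ) → RPt d → ℂ} (hG : IsDerivFamily G)
    (hB : ∀ α β, ∃ C, ∀ x, |monomialAt β x| * ‖G α x‖ ≤ C) :
    ∃ φ : 𝓢(RPt d, ℂ), ∀ α x, multiD α φ x = G α x := by
  have hdec : ∀ α k n, ∃ C, ∀ x, ‖x‖ ^ k * ‖iteratedFDeriv ℝ n (G α) x‖ ≤ C := by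
    intro α k n
    obtain ⟨A, hA0, hA⟩ := exists_uniform_bound hB (multiLength α + n) k
    refine ⟨_, fun x => hG.norm_pow_mul_iteratedFDeriv_le k n α hA0 x fun γ β hγ hβ => ?_⟩
    exact hA _ _ (by rw [multiLength_add, hγ]) hβ x
  let φ : (Fin d → ℕ) → 𝓢(RPt d, ℂ) := fun α => ⟨G α, hG.contDiff α, hdec α⟩
  refine ⟨φ 0, ?_⟩
  -- Each `G α` is itself a Schwartz function, so the derivatives of `φ 0` can be identified one
  -- unit index at a time.
  have : ∀ α, multiD α (φ 0) = φ α := by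
    intro α
    induction α using multiIndex_induction with
    | h0 => exact multiD_zero _
    | h1 α i ih =>
      rw [multiD_add_unitIndex, ih]
      ext x
      rw [partialD_apply]
      change fderiv ℝ (G α) x _ = G (α + unitIndex i) x
      rw [(hG α x).fderiv, gradCLM_single]
  intro α x
  rw [this]; rfl

lemma exists_monomialAt_mul_multiD_le {d : ℕ} (f : 𝓢(RPt d, ℂ)) (α β : Fin d → ℕ) :
    ∃ C, ∀ x, |monomialAt β x| * ‖multiD α f x‖ ≤ C := by
  refine ⟨SchwartzMap.seminorm ℂ (multiLength β) 0 (multiD α f), fun x => ?_⟩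
  refine le_trans ?_ (SchwartzMap.norm_pow_mul_le_seminorm ℂ (multiD α f) (multiLength β) x)
  exact mul_le_mul_of_nonneg_right (abs_monomialAt_le β x) (norm_nonneg _)

/-! ### Weighted bounds -/

/-- The bound `v(α, β) |x^β ∂^α f(x)| ≤ A`, uniformly in `α`, `β`, `x`. -/
def WeightBound {d : ℕ} (v : (Fin d → ℕ) → (Fin d → ℕ) → ℝ) (A : ℝ) (f : 𝓢(RPt d, ℂ)) : Prop :=
  ∀ α β x, v α β * (|monomialAt β x| * ‖multiD α f x‖) ≤ A

/-- The weight `v` dominates `v'` so strongly that one derivative, one power of a coordinate, and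
one factor `α_i` or `β_i` are gained. -/
structure Dominates {d : ℕ} (C : ℝ) (v' v : (Fin d → ℕ) → (Fin d → ℕ) → ℝ) : Prop where
  nonneg : ∀ α β, 0 ≤ v' α β
  raise : ∀ α β i, v' α β ≤ C * v α (β + unitIndex i)
  deriv : ∀ α β i, v' α β ≤ C * v (α + unitIndex i) β
  lower : ∀ α β i, (β i : ℝ) * v' α β ≤ C * v α (β - unitIndex i)
  freq : ∀ α β i, (α i : ℝ) * v' α β ≤ C * v α β

/-- The truncated subtraction `β - unitIndex i` is harmless: where it truncates, the factor `β i` is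
zero. -/
lemma hasFDerivAt_monomialAt {d : ℕ} (β : Fin d → ℕ) (x : RPt d) :
    HasFDerivAt (monomialAt β) (∑ i, ((β i : ℝ) * monomialAt (β - unitIndex i) x) •
      (EuclideanSpace.proj i : RPt d →L[ℝ] ℝ)) x := by
  have h := HasFDerivAt.finsetProd (u := Finset.univ) (x := x)
    (g := fun (i : Fin d) (y : RPt d) => y i ^ β i)
    (g' := fun i => ((β i : ℝ) * x i ^ (β i - 1)) • (EuclideanSpace.proj i : RPt d →L[ℝ] ℝ))
    (fun i _ => by
      have := ((EuclideanSpace.proj i : RPt d →L[ℝ] ℝ).hasFDerivAt (x := x)).pow (β i)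
      simpa using this)
  refine h.congr_fderiv (Finset.sum_congr rfl fun i _ => ?_)
  rw [smul_smul]
  congr 1
  rw [mul_left_comm]
  congr 1
  rw [monomialAt, ← Finset.mul_prod_erase _ _ (Finset.mem_univ i), mul_comm]
  congr 1
  · simp
  · refine Finset.prod_congr rfl fun j hj => ?_
    simp [Finset.ne_of_mem_erase hj]

/-- The `N`-th grid `(1/N) ℤ^d ∩ [-N, N]^d`. -/
def gridPoint {d : ℕ} (N : ℕ) (a : Fin d → Fin (2 * N ^ 2 + 1)) : RPt d :=
  WithLp.toLp 2 fun i => ((a i : ℕ) : ℝ) / N - N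

lemma exists_gridPoint_near {d N : ℕ} (hN : 0 < N) {x : RPt d} (hx : ∀ i, |x i| ≤ N) :
    ∃ a, ‖x - gridPoint N a‖ ≤ d / N := by
  have hN' : (0 : ℝ) < N := by exact_mod_cast hN
  have hx' : ∀ i, 0 ≤ (x i + N) * N ∧ (x i + N) * N ≤ 2 * N ^ 2 := fun i => by
    have := abs_le.1 (hx i)
    constructor
    · exact mul_nonneg (by linarith) hN'.le
    · nlinarith
  refine ⟨fun i => ⟨⌊(x i + N) * N⌋₊, ?_⟩, ?_⟩
  · rw [Nat.lt_succ_iff]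
    refine Nat.floor_le_of_le ?_
    push_cast
    exact (hx' i).2
  · refine (norm_le_sum_abs _).trans ?_
    have : ∀ i ∈ (Finset.univ : Finset (Fin d)),
        |(x - gridPoint N fun i => ⟨⌊(x i + N) * N⌋₊, by
          rw [Nat.lt_succ_iff]
          refine Nat.floor_le_of_le ?_
          push_cast
          exact (hx' i).2⟩) i| ≤ 1 / N := by
      intro i _
      have h1 := Nat.floor_le (hx' i).1
      have h2 := Nat.lt_floor_add_one ((x i + N) * N)
      simp only [gridPoint, PiLp.sub_apply]
      rw [abs_le]
      constructor
      · have : ((⌊(x i + N) * N⌋₊ : ℕ) : ℝ) / N ≤ x i + N := by rwa [div_le_iff₀ hN']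
        have : (0 : ℝ) ≤ 1 / N := by positivity
        linarith
      · have : x i + N ≤ (((⌊(x i + N) * N⌋₊ : ℕ) : ℝ) + 1) / N := by
          rw [le_div_iff₀ hN']; exact h2.le
        rw [add_div] at this
        linarith
    refine (Finset.sum_le_sum this).trans ?_
    simp [div_eq_mul_inv]

/-- If the derivatives of `f` of orders at most `N` vanish on the `N`-th grid, then passing to a
dominated weight gains a factor `1/N`. -/
lemma WeightBound.of_vanishing {d N : ℕ} (hN : 0 < N) {C A : ℝ} (hA : 0 ≤ A) (hC : 0 ≤ C)
    {v' v : (Fin d → ℕ) → (Fin d → ℕ) → ℝ} (hv : Dominates C v' v) {f : 𝓢(RPt d, ℂ)}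
    (hf : WeightBound v A f)
    (h0 : ∀ α : Fin d → ℕ, (∀ i, α i ≤ N) → (∃ β, v' α β ≠ 0) →
      ∀ a, multiD α f (gridPoint N a) = 0) :
    WeightBound v' ((1 + 2 * d ^ 2) * C / N * A) f := by
  intro α β x
  have hN' : (0 : ℝ) < N := by exact_mod_cast hN
  have hCA : 0 ≤ C * A := mul_nonneg hC hA
  have hbig : C / N * A ≤ (1 + 2 * (d : ℝ) ^ 2) * C / N * A := by
    have : (1 + 2 * (d : ℝ) ^ 2) * C / N * A = C / N * A + 2 * (d : ℝ) ^ 2 * (C * A) / N := by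
      ring
    rw [this]
    have : 0 ≤ 2 * (d : ℝ) ^ 2 * (C * A) / N := by positivity
    linarith
  have hscale : ∀ {a b : ℝ}, a ≤ C * b → ∀ {t : ℝ}, 0 ≤ t → b * t ≤ A →
      a * t ≤ C * A := by
    intro a b hab t ht hbt
    calc a * t ≤ C * b * t := mul_le_mul_of_nonneg_right hab ht
      _ = C * (b * t) := by ring
      _ ≤ C * A := mul_le_mul_of_nonneg_left hbt hC
  by_cases hα : ∀ i, α i ≤ N
  swap
  -- A high derivative: the factor `α i > N` in `freq` supplies the gain.
  · push Not at hα
    obtain ⟨i, hi⟩ := hα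
    refine le_trans ?_ hbig
    have ht : 0 ≤ |monomialAt β x| * ‖multiD α f x‖ := by positivity
    have h1 := hscale (hv.freq α β i) ht (hf α β x)
    have h2 : (N : ℝ) * v' α β ≤ α i * v' α β :=
      mul_le_mul_of_nonneg_right (by exact_mod_cast hi.le) (hv.nonneg α β)
    rw [div_mul_eq_mul_div, le_div_iff₀' hN', ← mul_assoc]
    exact (mul_le_mul_of_nonneg_right h2 ht).trans h1
  by_cases hx : ∀ i, |x i| ≤ N
  swap
  -- A distant point: one more power of `x i`, with `|x i| > N`, supplies the gain through `raise`.
  · push Not at hx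
    obtain ⟨i, hi⟩ := hx
    refine le_trans ?_ hbig
    have h1 := hscale (hv.raise α β i) (t := |monomialAt (β + unitIndex i) x| * ‖multiD α f x‖)
      (by positivity) (hf α _ x)
    rw [monomialAt_add, monomialAt_unitIndex, abs_mul] at h1
    rw [div_mul_eq_mul_div, le_div_iff₀' hN']
    refine le_trans ?_ h1
    have hp : 0 ≤ v' α β * (|monomialAt β x| * ‖multiD α f x‖) :=
      mul_nonneg (hv.nonneg α β) (by positivity)
    calc _ ≤ |x i| * (v' α β * (|monomialAt β x| * ‖multiD α f x‖)) :=
          mul_le_mul_of_nonneg_right hi.le hp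
      _ = _ := by ring
  -- The remaining case compares `z ↦ z^β ∂^α f(z)` at `x` with its zero at the grid point. The
  -- product rule gives `d` terms controlled by `deriv` and `d` controlled by `lower`, and the
  -- distance is at most `d / N`; this is the origin of `2 * d ^ 2`.
  obtain ⟨a, ha⟩ := exists_gridPoint_near hN hx
  rcases (hv.nonneg α β).eq_or_lt' with hv0 | hv0
  · rw [hv0, zero_mul]; positivity
  have hfam := isDerivFamily_multiD f
  have hd : ∀ z ∈ Set.univ, HasFDerivWithinAt (fun z => monomialAt β z • multiD α f z)
      (monomialAt β z • (gradCLM fun i => multiD (α + unitIndex i) f z) +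
        (∑ i, ((β i : ℝ) * monomialAt (β - unitIndex i) z) •
          (EuclideanSpace.proj i : RPt d →L[ℝ] ℝ)).smulRight (multiD α f z)) Set.univ z :=
    fun z _ => ((hasFDerivAt_monomialAt β z).smul (hfam α z)).hasFDerivWithinAt
  have hb : ∀ z ∈ Set.univ, ‖monomialAt β z • (gradCLM fun i => multiD (α + unitIndex i) f z) +
        (∑ i, ((β i : ℝ) * monomialAt (β - unitIndex i) z) •
          (EuclideanSpace.proj i : RPt d →L[ℝ] ℝ)).smulRight (multiD α f z)‖
      ≤ 2 * d * (C * A) / v' α β := by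
    intro z _
    rw [le_div_iff₀' hv0]
    have e1 : v' α β * ‖monomialAt β z • (gradCLM fun i => multiD (α + unitIndex i) f z)‖
        ≤ d * (C * A) := by
      rw [norm_smul, Real.norm_eq_abs]
      calc _ ≤ v' α β * (|monomialAt β z| * ∑ i, ‖multiD (α + unitIndex i) f z‖) := by
            gcongr; exact norm_gradCLM_le _
        _ = ∑ i, v' α β * (|monomialAt β z| * ‖multiD (α + unitIndex i) f z‖) := by
            simp only [Finset.mul_sum]
        _ ≤ ∑ _i : Fin d, C * A := Finset.sum_le_sum fun i _ =>
            hscale (hv.deriv α β i) (by positivity) (hf _ β z)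
        _ = _ := by simp
    have e2 : v' α β * ‖(∑ i, ((β i : ℝ) * monomialAt (β - unitIndex i) z) •
          (EuclideanSpace.proj i : RPt d →L[ℝ] ℝ)).smulRight (multiD α f z)‖ ≤ d * (C * A) := by
      rw [ContinuousLinearMap.norm_smulRight_apply]
      calc _ ≤ v' α β * ((∑ i, β i * |monomialAt (β - unitIndex i) z|) * ‖multiD α f z‖) := by
            gcongr
            refine (norm_sum_le _ _).trans (Finset.sum_le_sum fun i _ => ?_)
            rw [norm_smul, norm_mul, Real.norm_eq_abs, Real.norm_eq_abs, Nat.abs_cast]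
            exact mul_le_of_le_one_right (by positivity) (norm_proj_le i)
        _ = ∑ i, (β i * v' α β) * (|monomialAt (β - unitIndex i) z| * ‖multiD α f z‖) := by
            rw [Finset.sum_mul, Finset.mul_sum]
            exact Finset.sum_congr rfl fun i _ => by ring
        _ ≤ ∑ _i : Fin d, C * A := Finset.sum_le_sum fun i _ =>
            hscale (hv.lower α β i) (by positivity) (hf α _ z)
        _ = _ := by simp
    calc _ ≤ v' α β * (‖monomialAt β z • (gradCLM fun i => multiD (α + unitIndex i) f z)‖ +
          ‖(∑ i, ((β i : ℝ) * monomialAt (β - unitIndex i) z) •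
          (EuclideanSpace.proj i : RPt d →L[ℝ] ℝ)).smulRight (multiD α f z)‖) := by
          gcongr; exact norm_add_le _ _
      _ ≤ _ := by rw [mul_add]; linarith
  have hmv := Convex.norm_image_sub_le_of_norm_hasFDerivWithin_le hd hb convex_univ
    (Set.mem_univ (gridPoint N a)) (Set.mem_univ x)
  rw [h0 α hα ⟨β, hv0.ne'⟩ a, smul_zero, sub_zero, norm_smul, Real.norm_eq_abs] at hmv
  calc _ ≤ v' α β * (2 * d * (C * A) / v' α β * (d / N)) := by
        refine mul_le_mul_of_nonneg_left (hmv.trans ?_) hv0.le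
        gcongr
    _ = 2 * (d : ℝ) ^ 2 * C / N * A := by field_simp
    _ ≤ _ := by
        have h3 : (1 + 2 * (d : ℝ) ^ 2) * C / N * A
            = C * A / N + 2 * (d : ℝ) ^ 2 * C / N * A := by ring
        rw [h3]
        have : 0 ≤ C * A / N := by positivity
        linarith

/-! ### Approximate Auerbach bases -/

/-- The determinants have a finite supremum by the bound on `Φ`, and a positive one by surjectivity.
Compactness is not available, so the maximum of Auerbach's lemma is replaced by a system reaching
more than half the supremum. -/
lemma exists_almost_maximal_det {E : Type*} [AddCommGroup E] [Module ℂ E] (ρ : Seminorm ℂ E)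
    {n : ℕ} (Φ : E →ₗ[ℂ] (Fin n → ℂ)) (hΦ : Function.Surjective Φ) {C : ℝ}
    (hC : ∀ f i, ‖Φ f i‖ ≤ C * ρ f) :
    ∃ e : Fin n → E, (∀ i, ρ (e i) ≤ 1) ∧ (Matrix.of fun i j => Φ (e j) i).det ≠ 0 ∧
      ∀ e' : Fin n → E, (∀ i, ρ (e' i) ≤ 1) →
        ‖(Matrix.of fun i j => Φ (e' j) i).det‖ ≤ 2 * ‖(Matrix.of fun i j => Φ (e j) i).det‖ := by
  let S : Set ℝ := (fun e : Fin n → E => ‖(Matrix.of fun i j => Φ (e j) i).det‖) ''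
    {e | ∀ i, ρ (e i) ≤ 1}
  have hbdd : BddAbove S := by
    refine ⟨(n.factorial : ℝ) * |C| ^ n, ?_⟩
    rintro _ ⟨e, he, rfl⟩
    have := Matrix.det_le (A := Matrix.of fun i j => Φ (e j) i)
      (abv := NormedField.toAbsoluteValue ℂ) (x := |C|) fun i j => by
        refine (hC _ _).trans ?_
        calc C * ρ (e j) ≤ |C| * ρ (e j) :=
              mul_le_mul_of_nonneg_right (le_abs_self C) (apply_nonneg ρ _)
          _ ≤ |C| := mul_le_of_le_one_right (abs_nonneg C) (he j)
    rw [Fintype.card_fin, nsmul_eq_mul] at this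
    exact this
  obtain ⟨e₀, he₀, hdet₀⟩ : ∃ e : Fin n → E, (∀ i, ρ (e i) ≤ 1) ∧
      (Matrix.of fun i j => Φ (e j) i).det ≠ 0 := by
    choose g hg using fun j : Fin n => hΦ (Pi.single j 1)
    let c : ℝ := (1 + ∑ j, ρ (g j))⁻¹
    have hs : 0 < 1 + ∑ j, ρ (g j) := by positivity
    have hc : 0 < c := inv_pos.2 hs
    refine ⟨fun j => (c : ℂ) • g j, fun j => ?_, ?_⟩
    · rw [map_smul_eq_mul, Complex.norm_real, Real.norm_of_nonneg hc.le]
      have : ρ (g j) ≤ 1 + ∑ j, ρ (g j) := by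
        have := Finset.single_le_sum (f := fun j => ρ (g j)) (fun _ _ => apply_nonneg ρ _)
          (Finset.mem_univ j)
        linarith
      rw [inv_mul_le_iff₀ hs]; linarith
    · have : (Matrix.of fun i j => Φ ((c : ℂ) • g j) i) = (c : ℂ) • (1 : Matrix (Fin n) (Fin n) ℂ) := by
        ext i j
        simp [hg, Matrix.one_apply, Pi.single_apply]
      rw [this, Matrix.det_smul, Matrix.det_one, mul_one]
      exact pow_ne_zero _ (by exact_mod_cast hc.ne')
  have hpos : 0 < sSup S :=
    (norm_pos_iff.2 hdet₀).trans_le (le_csSup hbdd ⟨e₀, he₀, rfl⟩)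
  obtain ⟨_, ⟨e, he, rfl⟩, hlt⟩ := exists_lt_of_lt_csSup (s := S) ⟨_, e₀, he₀, rfl⟩
    (half_lt_self hpos)
  refine ⟨e, he, ?_, fun e' he' => ?_⟩
  · rw [← norm_pos_iff]; exact (half_pos hpos).trans hlt
  · have := le_csSup hbdd (Set.mem_image_of_mem _ he')
    dsimp only at this hlt
    linarith

/-- By Cramer's rule the coefficients of `Φ f` in the vectors `Φ (e j)` are quotients of
determinants. Near-maximality of the denominator makes them at most `2 * ρ f`, so `n` terms give `2
* n`. -/
lemma exists_projection_of_surjective {E : Type*} [AddCommGroup E] [Module ℂ E]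
    (ρ : Seminorm ℂ E) {n : ℕ} (Φ : E →ₗ[ℂ] (Fin n → ℂ)) (hΦ : Function.Surjective Φ) {C : ℝ}
    (hC : ∀ f i, ‖Φ f i‖ ≤ C * ρ f) :
    ∃ R : (Fin n → ℂ) →ₗ[ℂ] E, ∀ f, Φ (f - R (Φ f)) = 0 ∧
      ρ (f - R (Φ f)) ≤ (1 + 2 * n) * ρ f := by
  obtain ⟨e, he, hdet, hmax⟩ := exists_almost_maximal_det ρ Φ hΦ hC
  set M : Matrix (Fin n) (Fin n) ℂ := Matrix.of fun i j => Φ (e j) i with hM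
  let c : (Fin n → ℂ) →ₗ[ℂ] (Fin n → ℂ) := M.det⁻¹ • Matrix.cramer M
  let R : (Fin n → ℂ) →ₗ[ℂ] E := (Fintype.linearCombination ℂ e) ∘ₗ c
  have hR : ∀ b, R b = ∑ j, c b j • e j := fun b => by
    simp [R, Fintype.linearCombination_apply]
  have hcoef : ∀ f j, ‖c (Φ f) j‖ ≤ 2 * ρ f := by
    have key : ∀ f, ρ f ≤ 1 → ∀ j, ‖c (Φ f) j‖ ≤ 2 := by
      intro f hf j
      -- Cramer's numerator is the determinant of the system with `e j` replaced by `f`, which is an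
      -- admissible competitor when `ρ f ≤ 1`.
      have h1 : (M.updateCol j (Φ f)) = Matrix.of fun i k => Φ (Function.update e j f k) i := by
        ext i k
        by_cases hk : k = j
        · subst hk; simp
        · simp [hk, hM]
      have h2 := hmax (Function.update e j f) fun i => by
        by_cases hi : i = j
        · subst hi; simpa using hf
        · simpa [hi] using he i
      simp only [c, LinearMap.smul_apply, Pi.smul_apply, Matrix.cramer_apply, h1, smul_eq_mul,
        norm_mul, norm_inv]
      rw [inv_mul_le_iff₀ (norm_pos_iff.2 hdet), mul_comm]
      exact h2
    intro f j
    -- Scaling by `2 / t` with `t > 2 * ρ f`, instead of dividing by `ρ f`, also covers `ρ f = 0`.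
    refine le_of_forall_gt_imp_ge_of_dense fun t ht => ?_
    have hρ := apply_nonneg ρ f
    have ht0 : 0 < t := lt_of_le_of_lt (by positivity) ht
    have h3 := key (((2 / t : ℝ) : ℂ) • f) (by
      rw [map_smul_eq_mul, Complex.norm_real, Real.norm_of_nonneg (by positivity),
        div_mul_eq_mul_div, div_le_one ht0]
      exact ht.le) j
    rw [map_smul, map_smul, Pi.smul_apply, norm_smul, Complex.norm_real,
      Real.norm_of_nonneg (by positivity), div_mul_eq_mul_div, div_le_iff₀ ht0] at h3
    linarith
  refine ⟨R, fun f => ⟨?_, ?_⟩⟩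
  · have h1 : Φ (R (Φ f)) = M.mulVec (c (Φ f)) := by
      ext i
      rw [hR, map_sum, Finset.sum_apply, Matrix.mulVec, dotProduct]
      exact Finset.sum_congr rfl fun j _ => by simp [hM, mul_comm]
    rw [map_sub, h1]
    simp only [c, LinearMap.smul_apply, Matrix.mulVec_smul, Matrix.mulVec_cramer, smul_smul,
      inv_mul_cancel₀ hdet, one_smul, sub_self]
  · have h2 : ρ (R (Φ f)) ≤ n * (2 * ρ f) := by
      rw [hR]
      refine (Finset.le_sum_of_subadditive ρ (map_zero ρ).le (map_add_le_add ρ) _ _).trans ?_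
      refine (Finset.sum_le_sum (g := fun _ => 2 * ρ f) fun j _ => ?_).trans (by simp)
      rw [map_smul_eq_mul]
      have := mul_le_mul (hcoef f j) (he j) (apply_nonneg ρ _) (by positivity)
      linarith
    have := map_sub_le_add ρ f (R (Φ f))
    linarith

/-- Given finitely many functionals that are bounded with respect to a seminorm, there is a
finite-rank map, factoring through `ℂ^n` with `n` at most the number of functionals, that does not
change the functionals and whose seminorm is bounded polynomially in `n`. -/
lemma exists_finiteRank_interpolation {E : Type*} [AddCommGroup E] [Module ℂ E]
    (ρ : Seminorm ℂ E) {ι : Type*} [Fintype ι] (ℓ : ι → E →ₗ[ℂ] ℂ) {C : ℝ}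
    (hC : ∀ i f, ‖ℓ i f‖ ≤ C * ρ f) :
    ∃ n ≤ Fintype.card ι, ∃ (Q : E →ₗ[ℂ] (Fin n → ℂ)) (R : (Fin n → ℂ) →ₗ[ℂ] E), ∀ f,
      (∀ i, ℓ i (f - R (Q f)) = 0) ∧ ρ (f - R (Q f)) ≤ (1 + 2 * n) * ρ f := by
  let L : E →ₗ[ℂ] (ι → ℂ) := LinearMap.pi ℓ
  -- The functionals may be linearly dependent. Coordinates on the range of `L` restore the
  -- surjectivity that the determinant argument needs, and `n` is their rank.
  let W := LinearMap.range L
  let n := Module.finrank ℂ W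
  let b : Module.Basis (Fin n) ℂ W := Module.finBasis ℂ W
  let Ψ : W ≃ₗ[ℂ] (Fin n → ℂ) := b.equivFun
  let Φ : E →ₗ[ℂ] (Fin n → ℂ) := Ψ.toLinearMap ∘ₗ L.rangeRestrict
  have hΦ : Function.Surjective Φ := Ψ.surjective.comp L.surjective_rangeRestrict
  let Ψc : W →L[ℂ] (Fin n → ℂ) := LinearMap.toContinuousLinearMap Ψ.toLinearMap
  have hbound : ∀ f i, ‖Φ f i‖ ≤ (‖Ψc‖ * |C|) * ρ f := by
    intro f i
    have h1 : ‖Φ f i‖ ≤ ‖Ψc (L.rangeRestrict f)‖ := norm_le_pi_norm (Φ f) i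
    refine h1.trans ((Ψc.le_opNorm _).trans ?_)
    rw [mul_assoc]
    refine mul_le_mul_of_nonneg_left ?_ (norm_nonneg _)
    change ‖L f‖ ≤ _
    refine (pi_norm_le_iff_of_nonneg (mul_nonneg (abs_nonneg _) (apply_nonneg ρ f))).2 fun k => ?_
    exact (hC k f).trans (mul_le_mul_of_nonneg_right (le_abs_self C) (apply_nonneg ρ f))
  obtain ⟨R, hR⟩ := exists_projection_of_surjective ρ Φ hΦ hbound
  refine ⟨n, ?_, Φ, R, fun f => ⟨fun i => ?_, (hR f).2⟩⟩
  · exact (Submodule.finrank_le W).trans (by simp)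
  · have h1 : L.rangeRestrict (f - R (Φ f)) = 0 :=
      Ψ.injective (by rw [map_zero]; exact (hR f).1)
    have h2 : L (f - R (Φ f)) = 0 := congrArg Subtype.val h1
    exact congrFun h2 i

/-! ### Iterated gains along a chain of weights. -/

/-- The same vanishing samples serve every link, so the `q` gains of `1/N` multiply, while the
constant does not depend on `N`, `A` or `f`. -/
lemma exists_weightBound_of_chain {d q : ℕ} {V : ℕ → (Fin d → ℕ) → (Fin d → ℕ) → ℝ}
    (hV : ∀ n < q, ∃ C, 0 ≤ C ∧ Dominates C (V (n + 1)) (V n)) :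
    ∃ C, 0 ≤ C ∧ ∀ N : ℕ, 0 < N → ∀ A, 0 ≤ A → ∀ f : 𝓢(RPt d, ℂ), WeightBound (V 0) A f →
      (∀ α : Fin d → ℕ, (∀ i, α i ≤ N) → (∃ n < q, ∃ β, V (n + 1) α β ≠ 0) →
        ∀ a, multiD α f (gridPoint N a) = 0) →
      WeightBound (V q) (C / N ^ q * A) f := by
  induction q with
  | zero => exact ⟨1, zero_le_one, fun N _ A _ f hf _ => by simpa using hf⟩
  | succ q ih =>
    obtain ⟨C, hC, h⟩ := ih fun n hn => hV n (hn.trans (Nat.lt_succ_self q))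
    obtain ⟨C', hC', h'⟩ := hV q (Nat.lt_succ_self q)
    refine ⟨(1 + 2 * d ^ 2) * C' * C, by positivity, fun N hN A hA f hf h0 => ?_⟩
    have h1 := h N hN A hA f hf fun α hα ⟨n, hn, hβ⟩ =>
      h0 α hα ⟨n, hn.trans (Nat.lt_succ_self q), hβ⟩
    have h2 := WeightBound.of_vanishing hN (by positivity) hC' h' h1
      fun α hα hβ => h0 α hα ⟨q, Nat.lt_succ_self q, hβ⟩
    have h3 : (1 + 2 * (d : ℝ) ^ 2) * C' * C / N ^ (q + 1) * A
        = (1 + 2 * d ^ 2) * C' / N * (C / N ^ q * A) := by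
      rw [pow_succ]; ring
    rw [h3]; exact h2

/-! ### Partial derivatives of slices -/

/-- `x ↦ (x, 0)` as a continuous linear map. -/
def inlCLM (m n : ℕ) : RPt m →L[ℝ] RPt (m + n) :=
  LinearMap.toContinuousLinearMap
    { toFun := fun x => pairPt x 0
      map_add' := fun y z => by
        ext i; refine Fin.addCases (fun i => ?_) (fun i => ?_) i <;>
          simp [pairPt_castAdd, pairPt_natAdd]
      map_smul' := fun c y => by
        ext i; refine Fin.addCases (fun i => ?_) (fun i => ?_) i <;>
          simp [pairPt_castAdd, pairPt_natAdd] }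

lemma inlCLM_apply {m n : ℕ} (x : RPt m) : inlCLM m n x = pairPt x 0 := rfl

lemma gradCLM_comp_inlCLM {m n : ℕ} (c : Fin (m + n) → ℂ) :
    (gradCLM c).comp (inlCLM m n) = gradCLM fun i => c (Fin.castAdd n i) := by
  ext z
  simp [gradCLM_apply, inlCLM_apply, Fin.sum_univ_add, pairPt_castAdd, pairPt_natAdd]

lemma append_add_unitIndex {m n : ℕ} (γ : Fin m → ℕ) (α : Fin n → ℕ) (i : Fin m) :
    (Fin.append γ α : Fin (m + n) → ℕ) + unitIndex (Fin.castAdd n i)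
      = Fin.append (γ + unitIndex i) α := by
  ext k
  refine Fin.addCases (fun k => ?_) (fun k => ?_) k
  · simp [Pi.single_apply, Fin.ext_iff]
  · have : Fin.natAdd m k ≠ Fin.castAdd n i := by
      intro h; have := congrArg Fin.val h; simp at this; omega
    simp [this]

lemma multiD_sliceS_append {m n : ℕ} (γ : Fin m → ℕ) (α : Fin n → ℕ) (x : RPt m) (y : RPt n)
    (K : 𝓢(RPt (m + n), ℂ)) :
    multiD α (sliceS x (multiD (Fin.append γ 0) K)) y
      = multiD (Fin.append γ α) K (pairPt x y) := by
  rw [multiD_sliceS, sliceS_apply, ← multiD_add_apply]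
  congr 3
  ext k
  refine Fin.addCases (fun k => ?_) (fun k => ?_) k <;> simp [padLeft]

/-- Freezing `α` and `y` makes Taylor's estimate in `x` available for every derivative of the
slices. -/
lemma isDerivFamily_append {m n : ℕ} (K : 𝓢(RPt (m + n), ℂ)) (α : Fin n → ℕ) (y : RPt n) :
    IsDerivFamily fun (γ : Fin m → ℕ) x => multiD (Fin.append γ α) K (pairPt x y) := by
  intro γ x
  have hp : HasFDerivAt (fun x : RPt m => pairPt x y) (inlCLM m n) x := by
    have : (fun x : RPt m => pairPt x y) = fun x => inlCLM m n x + pairPt 0 y := by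
      ext x i
      refine Fin.addCases (fun i => ?_) (fun i => ?_) i <;>
        simp [inlCLM_apply, pairPt_castAdd, pairPt_natAdd]
    rw [this]
    exact (inlCLM m n).hasFDerivAt.add_const _
  have h := (isDerivFamily_multiD K (Fin.append γ α) (pairPt x y)).comp x hp
  rw [gradCLM_comp_inlCLM] at h
  simp only [append_add_unitIndex] at h
  exact h

/-! ### Quasi-Banach spaces -/

section QuasiBanach

variable {B : Type*} [AddCommGroup B] [Module ℂ B] [QuasiBanachSpace B]

lemma quasiBall_mem_nhds_zero {ε : ℝ} (hε : 0 < ε) : {f : B | ‖f‖ < ε} ∈ 𝓝 (0 : B) := by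
  obtain ⟨D, hD, htri⟩ := QuasiBanachSpace.exists_quasi_triangle (B := B)
  have hD0 : 0 < D := one_pos.trans_le hD
  -- Balls of a quasi-norm need not be open, so an open set inside the ball is exhibited. Halving by
  -- `2 * D` compensates for the constant of the quasi-triangle inequality.
  let U : Set B := {f | ∃ δ > (0 : ℝ), ∀ g : B, ‖g - f‖ < δ → ‖g‖ < ε}
  have hU : IsOpen U := by
    refine (QuasiBanachSpace.isOpen_iff_ball U).2 ?_
    rintro f ⟨δ, hδ, hf⟩
    refine ⟨δ / (2 * D), by positivity, fun g hg => ⟨δ / (2 * D), by positivity, fun e he => ?_⟩⟩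
    refine hf e ?_
    have h1 := htri (e - g) (g - f)
    rw [sub_add_sub_cancel] at h1
    have h2 : D * (‖e - g‖ + ‖g - f‖) < D * (δ / (2 * D) + δ / (2 * D)) := by gcongr
    have h3 : D * (δ / (2 * D) + δ / (2 * D)) = δ := by field_simp; ring
    linarith
  have hz : ‖(0 : B)‖ = 0 := (QuasiBanachSpace.norm_eq_zero_iff' 0).2 rfl
  refine mem_of_superset (hU.mem_nhds ⟨ε, hε, fun g hg => by simpa using hg⟩) ?_
  rintro f ⟨δ, hδ, hf⟩
  exact hf f (by simpa [hz] using hδ)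

lemma exists_quasiBall_subset {U : Set B} (hU : U ∈ 𝓝 (0 : B)) :
    ∃ ε > 0, ∀ f : B, ‖f‖ < ε → f ∈ U := by
  obtain ⟨W, hWU, hW, h0⟩ := mem_nhds_iff.1 hU
  obtain ⟨ε, hε, h⟩ := (QuasiBanachSpace.isOpen_iff_ball W).1 hW 0 h0
  exact ⟨ε, hε, fun f hf => hWU (h f (by simpa using hf))⟩

lemma quasiNorm_nonneg (f : B) : 0 ≤ ‖f‖ := QuasiBanachSpace.norm_nonneg' f

lemma quasiNorm_real_smul {c : ℝ} (hc : 0 ≤ c) (f : B) : ‖(c : ℂ) • f‖ = c * ‖f‖ := by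
  rw [QuasiBanachSpace.norm_smul', Complex.norm_real, Real.norm_of_nonneg hc]

/-- A continuous linear map into a strong dual is bounded on bounded sets, uniformly on the unit
ball. -/
lemma exists_bound_of_isVonNBounded {X : Type*} [AddCommGroup X] [Module ℂ X]
    [TopologicalSpace X] {j : B →ₗ[ℂ] StrongDual ℂ X} (hj : Continuous j) {S : Set X}
    (hS : Bornology.IsVonNBounded ℂ S) :
    ∃ C, 0 ≤ C ∧ ∀ f, ∀ ψ ∈ S, ‖j f ψ‖ ≤ C * ‖f‖ := by
  have h1 : {u : StrongDual ℂ X | ∀ ψ ∈ S, u ψ ∈ Metric.ball (0 : ℂ) 1} ∈ 𝓝 (0 : StrongDual ℂ X) :=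
    ContinuousLinearMap.hasBasis_nhds_zero.mem_of_mem (i := (S, Metric.ball (0 : ℂ) 1))
      ⟨hS, Metric.ball_mem_nhds _ one_pos⟩
  have h2 : j ⁻¹' {u : StrongDual ℂ X | ∀ ψ ∈ S, u ψ ∈ Metric.ball (0 : ℂ) 1} ∈ 𝓝 (0 : B) :=
    hj.continuousAt.preimage_mem_nhds (by rwa [map_zero])
  obtain ⟨ε, hε, h⟩ := exists_quasiBall_subset h2
  refine ⟨2 / ε, by positivity, fun f ψ hψ => ?_⟩
  refine le_of_forall_gt_imp_ge_of_dense fun t ht => ?_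
  have ht0 : 0 < t := lt_of_le_of_lt (mul_nonneg (by positivity) (quasiNorm_nonneg f)) ht
  have h3 := h (((1 / t : ℝ) : ℂ) • f) (by
    rw [quasiNorm_real_smul (by positivity), one_div_mul_eq_div, div_lt_iff₀ ht0]
    rw [div_mul_eq_mul_div, div_lt_iff₀ hε] at ht
    have := quasiNorm_nonneg f
    linarith) ψ hψ
  rw [map_smul, mem_ball_zero_iff, smul_apply, norm_smul,
    Complex.norm_real, Real.norm_of_nonneg (by positivity), one_div_mul_eq_div,
    div_lt_one ht0] at h3
  exact h3.le

end QuasiBanach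

/-! ### The transform `f ↦ ⟨f, K(x, ·)⟩` -/

/-- A space `X` of test functions, described by weighted bounds: `X` contains the functions with
finite `v`-bounds for all `v ∈ 𝒱`, and sets on which these bounds are uniform are bounded. -/
structure IsTestSpace {d : ℕ} {X : Type*} [AddCommGroup X] [Module ℂ X] [TopologicalSpace X]
    (toS : X →ₗ[ℂ] 𝓢(RPt d, ℂ)) (𝒱 : Set ((Fin d → ℕ) → (Fin d → ℕ) → ℝ)) : Prop where
  injective : Function.Injective toS
  exists_of_bound : ∀ ψ, (∀ v ∈ 𝒱, ∃ A, WeightBound v A ψ) → ∃ φ, toS φ = ψ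
  nonneg : ∀ v ∈ 𝒱, ∀ α β, 0 ≤ v α β
  exists_pos : ∀ α β, ∃ v ∈ 𝒱, 0 < v α β
  isVonNBounded : ∀ S : Set X, (∀ v ∈ 𝒱, ∃ A, ∀ φ ∈ S, WeightBound v A (toS φ)) →
    Bornology.IsVonNBounded ℂ S

/-- Weighted bounds for a kernel on a product. -/
def KernelBound {d₁ d₂ : ℕ} (V : (Fin d₂ → ℕ) → (Fin d₂ → ℕ) → ℝ)
    (v : (Fin d₁ → ℕ) → (Fin d₁ → ℕ) → ℝ) (A : ℝ) (K : 𝓢(RPt (d₂ + d₁), ℂ)) : Prop :=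
  ∀ γ κ x α β y, V γ κ * v α β * (|monomialAt κ x| * |monomialAt β y| *
    ‖multiD (Fin.append γ α) K (pairPt x y)‖) ≤ A

section

variable {d₁ d₂ : ℕ} {B : Type*} [AddCommGroup B] [Module ℂ B] [QuasiBanachSpace B]
  {X₁ : Type*} [AddCommGroup X₁] [Module ℂ X₁] [TopologicalSpace X₁]
  {X₂ : Type*} [AddCommGroup X₂] [Module ℂ X₂] [TopologicalSpace X₂]
  {toS₁ : X₁ →ₗ[ℂ] 𝓢(RPt d₁, ℂ)} {toS₂ : X₂ →ₗ[ℂ] 𝓢(RPt d₂, ℂ)}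
  {𝒱₁ : Set ((Fin d₁ → ℕ) → (Fin d₁ → ℕ) → ℝ)} {𝒱₂ : Set ((Fin d₂ → ℕ) → (Fin d₂ → ℕ) → ℝ)}
  {K : 𝓢(RPt (d₂ + d₁), ℂ)}

lemma KernelBound.derivative {V : (Fin d₂ → ℕ) → (Fin d₂ → ℕ) → ℝ}
    {v : (Fin d₁ → ℕ) → (Fin d₁ → ℕ) → ℝ} {A : ℝ} (hK : KernelBound V v A K)
    {γ : Fin d₂ → ℕ} (hγ : 0 < V γ 0) (x : RPt d₂) (α β : Fin d₁ → ℕ) (y : RPt d₁) :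
    v α β * (|monomialAt β y| * ‖multiD (Fin.append γ α) K (pairPt x y)‖) ≤ A / V γ 0 := by
  rw [le_div_iff₀' hγ]
  have := hK γ 0 x α β y
  rw [monomialAt_zero, abs_one, one_mul] at this
  linarith

/-- The partial derivatives in `x` of the slices `K(x, ·)` belong to the space of test functions. -/
lemma exists_sliceFamily (h₁ : IsTestSpace toS₁ 𝒱₁) (h₂ : IsTestSpace toS₂ 𝒱₂)
    (hK : ∀ V ∈ 𝒱₂, ∀ v ∈ 𝒱₁, ∃ A, KernelBound V v A K) :
    ∃ F : (Fin d₂ → ℕ) → RPt d₂ → X₁,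
      ∀ γ x, toS₁ (F γ x) = sliceS x (multiD (Fin.append γ 0) K) := by
  have : ∀ γ x, ∃ φ, toS₁ φ = sliceS x (multiD (Fin.append γ 0) K) := by
    intro γ x
    refine h₁.exists_of_bound _ fun v hv => ?_
    obtain ⟨V, hV, hpos⟩ := h₂.exists_pos γ 0
    obtain ⟨A, hA⟩ := hK V hV v hv
    refine ⟨A / V γ 0, fun α β y => ?_⟩
    rw [multiD_sliceS_append]
    exact hA.derivative hpos x α β y
  choose F hF using this
  exact ⟨F, hF⟩

variable {j : B →ₗ[ℂ] StrongDual ℂ X₁} {F : (Fin d₂ → ℕ) → RPt d₂ → X₁}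

/-- The weighted slices `V γ κ x^κ F γ x`, over all `γ`, `κ`, `x` together, form one bounded set, on
which `j f` is at most a constant times `‖f‖`. -/
lemma exists_decay_sliceFamily (h₁ : IsTestSpace toS₁ 𝒱₁)
    (hK : ∀ V ∈ 𝒱₂, ∀ v ∈ 𝒱₁, ∃ A, KernelBound V v A K) (hj : Continuous j)
    (hF : ∀ γ x, toS₁ (F γ x) = sliceS x (multiD (Fin.append γ 0) K))
    (h₂ : IsTestSpace toS₂ 𝒱₂) {V : (Fin d₂ → ℕ) → (Fin d₂ → ℕ) → ℝ} (hV : V ∈ 𝒱₂) :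
    ∃ C, 0 ≤ C ∧ ∀ f γ κ x, V γ κ * (|monomialAt κ x| * ‖j f (F γ x)‖) ≤ C * ‖f‖ := by
  let S : Set X₁ := Set.range fun p : (Fin d₂ → ℕ) × (Fin d₂ → ℕ) × RPt d₂ =>
    ((V p.1 p.2.1 * monomialAt p.2.1 p.2.2 : ℝ) : ℂ) • F p.1 p.2.2
  have hS : Bornology.IsVonNBounded ℂ S := by
    refine h₁.isVonNBounded S fun v hv => ?_
    obtain ⟨A, hA⟩ := hK V hV v hv
    refine ⟨A, ?_⟩
    rintro _ ⟨⟨γ, κ, x⟩, rfl⟩ α β y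
    dsimp only
    rw [map_smul, map_smul, smul_apply, norm_smul, Complex.norm_real, Real.norm_eq_abs, abs_mul,
      abs_of_nonneg (h₂.nonneg V hV γ κ), hF, multiD_sliceS_append]
    refine le_trans (le_of_eq ?_) (hA γ κ x α β y)
    ring
  obtain ⟨C, hC, h⟩ := exists_bound_of_isVonNBounded hj hS
  refine ⟨C, hC, fun f γ κ x => ?_⟩
  have := h f _ ⟨(γ, κ, x), rfl⟩
  dsimp only at this
  rw [map_smul, norm_smul, Complex.norm_real, Real.norm_eq_abs, abs_mul,
    abs_of_nonneg (h₂.nonneg V hV γ κ)] at this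
  rwa [← mul_assoc]

/-- Differentiation passes through `j f` because the first-order Taylor remainders of `x ↦ F γ x`,
divided by `‖z‖ ^ 2`, form a bounded set of test functions. The remainder of the pairing is then
`O(‖z‖ ^ 2)`. -/
lemma isDerivFamily_sliceFamily (h₁ : IsTestSpace toS₁ 𝒱₁) (h₂ : IsTestSpace toS₂ 𝒱₂)
    (hK : ∀ V ∈ 𝒱₂, ∀ v ∈ 𝒱₁, ∃ A, KernelBound V v A K) (hj : Continuous j)
    (hF : ∀ γ x, toS₁ (F γ x) = sliceS x (multiD (Fin.append γ 0) K)) (f : B) :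
    IsDerivFamily fun γ x => j f (F γ x) := by
  intro γ x
  let R : RPt d₂ → X₁ := fun z => F γ (x + z) - F γ x - ∑ i, (z i : ℂ) • F (γ + unitIndex i) x
  let S : Set X₁ := Set.range fun z : RPt d₂ => (((‖z‖ ^ 2)⁻¹ : ℝ) : ℂ) • R z
  have hS : Bornology.IsVonNBounded ℂ S := by
    refine h₁.isVonNBounded S fun v hv => ?_
    have hij : ∀ i k : Fin d₂, ∃ A, ∀ x α β y, v α β * (|monomialAt β y| *
        ‖multiD (Fin.append (γ + unitIndex i + unitIndex k) α) K (pairPt x y)‖) ≤ A := by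
      intro i k
      obtain ⟨V, hV, hpos⟩ := h₂.exists_pos (γ + unitIndex i + unitIndex k) 0
      obtain ⟨A, hA⟩ := hK V hV v hv
      exact ⟨_, fun x α β y => hA.derivative hpos x α β y⟩
    choose A hA using hij
    let M := ∑ i, ∑ k, |A i k|
    have hM : ∀ i k, A i k ≤ M := fun i k =>
      (le_abs_self _).trans ((Finset.single_le_sum (f := fun k => |A i k|)
        (fun _ _ => abs_nonneg _) (Finset.mem_univ k)).trans
        (Finset.single_le_sum (f := fun i => ∑ k, |A i k|)
          (fun _ _ => by positivity) (Finset.mem_univ i)))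
    have hM0 : 0 ≤ M := by positivity
    refine ⟨d₂ ^ 2 * M, ?_⟩
    rintro _ ⟨z, rfl⟩ α β y
    have hR : multiD α (toS₁ (R z)) y = multiD (Fin.append γ α) K (pairPt (x + z) y)
        - multiD (Fin.append γ α) K (pairPt x y)
        - ∑ i, (z i : ℂ) * multiD (Fin.append (γ + unitIndex i) α) K (pairPt x y) := by
      simp only [R, map_sub, map_sum, map_smul, sub_apply, sum_apply, smul_apply, hF,
        multiD_sliceS_append, smul_eq_mul]
    dsimp only
    rw [map_smul, map_smul, smul_apply, norm_smul, hR, Complex.norm_real,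
      Real.norm_of_nonneg (by positivity)]
    -- Taylor's estimate is applied with a bound divided by `v α β * |monomialAt β y|`, so the case
    -- where this vanishes is separate.
    rcases (mul_nonneg (h₁.nonneg v hv α β) (abs_nonneg (monomialAt β y))).eq_or_lt' with h0 | h0
    · rw [← mul_assoc, h0, zero_mul]; positivity
    have ht := (isDerivFamily_append K α y).norm_taylor_le γ
      (M := M / (v α β * |monomialAt β y|)) (fun i k x' => by
        rw [le_div_iff₀' h0, mul_assoc]
        exact (hA i k x' α β y).trans (hM i k)) x z
    rcases eq_or_ne z 0 with rfl | hz
    · simp; positivity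
    have hz' : 0 < ‖z‖ ^ 2 := by positivity
    calc _ = (v α β * |monomialAt β y|) * ((‖z‖ ^ 2)⁻¹ * _) := by rw [← mul_assoc]
      _ ≤ (v α β * |monomialAt β y|) * ((‖z‖ ^ 2)⁻¹ *
          (d₂ ^ 2 * (M / (v α β * |monomialAt β y|)) * ‖z‖ ^ 2)) := by
          gcongr
      _ = d₂ ^ 2 * M := by
          have := h0.ne'
          have := hz'.ne'
          set t := v α β * |monomialAt β y|
          field_simp
  obtain ⟨C, hC, h⟩ := exists_bound_of_isVonNBounded hj hS
  rw [hasFDerivAt_iff_isLittleO_nhds_zero]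
  have hO : (fun z : RPt d₂ => j f (F γ (x + z)) - j f (F γ x) -
      gradCLM (fun i => j f (F (γ + unitIndex i) x)) z) =O[𝓝 0] fun z => ‖z‖ ^ 2 := by
    refine Asymptotics.IsBigO.of_bound (C * ‖f‖) (Eventually.of_forall fun z => ?_)
    rcases eq_or_ne z 0 with rfl | hz
    · simp
    have h3 : j f (F γ (x + z)) - j f (F γ x) -
        gradCLM (fun i => j f (F (γ + unitIndex i) x)) z = j f (R z) := by
      simp only [R, map_sub, map_sum, map_smul, gradCLM_apply, smul_eq_mul]
    have h4 := h f _ ⟨z, rfl⟩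
    dsimp only at h4
    have hz' : 0 < ‖z‖ ^ 2 := by positivity
    rw [map_smul, norm_smul, Complex.norm_real, Real.norm_of_nonneg (by positivity),
      inv_mul_le_iff₀ hz'] at h4
    rw [h3, Real.norm_of_nonneg hz'.le, mul_comm]
    exact h4
  refine hO.trans_isLittleO ?_
  exact Asymptotics.isLittleO_norm_pow_id one_lt_two

/-- The map `f ↦ (x ↦ ⟨f, K(x, ·)⟩)` as a linear map into the test functions, with bounds. -/
lemma exists_kernelTransform (h₁ : IsTestSpace toS₁ 𝒱₁) (h₂ : IsTestSpace toS₂ 𝒱₂)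
    (hK : ∀ V ∈ 𝒱₂, ∀ v ∈ 𝒱₁, ∃ A, KernelBound V v A K) (hj : Continuous j)
    {slice : RPt d₂ → X₁} (hslice : ∀ x, toS₁ (slice x) = sliceS x K) :
    ∃ Φ : B →ₗ[ℂ] X₂, (∀ f x, toS₂ (Φ f) x = j f (slice x)) ∧
      ∀ V ∈ 𝒱₂, ∃ C, 0 ≤ C ∧ ∀ f, WeightBound V (C * ‖f‖) (toS₂ (Φ f)) := by
  obtain ⟨F, hF⟩ := exists_sliceFamily h₁ h₂ hK
  have hF0 : ∀ x, F 0 x = slice x := fun x => h₁.injective (by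
    rw [hF, hslice]
    have : (Fin.append 0 0 : Fin (d₂ + d₁) → ℕ) = 0 := by
      ext k; refine Fin.addCases (fun k => ?_) (fun k => ?_) k <;> simp
    rw [this, multiD_zero])
  have hdec := fun V hV => exists_decay_sliceFamily h₁ hK hj hF h₂ (V := V) hV
  have hex : ∀ f, ∃ φ : X₂, ∀ γ x, multiD γ (toS₂ φ) x = j f (F γ x) := by
    intro f
    obtain ⟨ψ, hψ⟩ := (isDerivFamily_sliceFamily h₁ h₂ hK hj hF f).exists_schwartz fun γ κ => by
      obtain ⟨V, hV, hpos⟩ := h₂.exists_pos γ κ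
      obtain ⟨C, hC, h⟩ := hdec V hV
      exact ⟨C * ‖f‖ / V γ κ, fun x => by rw [le_div_iff₀' hpos]; exact h f γ κ x⟩
    obtain ⟨φ, hφ⟩ := h₂.exists_of_bound ψ fun V hV => by
      obtain ⟨C, hC, h⟩ := hdec V hV
      exact ⟨C * ‖f‖, fun γ κ x => by rw [hψ]; exact h f γ κ x⟩
    exact ⟨φ, fun γ x => by rw [hφ, hψ]⟩
  choose Φ hΦ using hex
  have hΦ0 : ∀ f x, toS₂ (Φ f) x = j f (F 0 x) := fun f x => by
    have := hΦ f 0 x; rwa [multiD_zero] at this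
  refine ⟨⟨⟨Φ, fun f g => ?_⟩, fun c f => ?_⟩, fun f x => ?_, fun V hV => ?_⟩
  · refine h₂.injective (SchwartzMap.ext fun x => ?_)
    rw [map_add, add_apply, hΦ0, hΦ0, hΦ0, map_add, add_apply]
  · refine h₂.injective (SchwartzMap.ext fun x => ?_)
    dsimp only [RingHom.id_apply]
    rw [map_smul, smul_apply, hΦ0, hΦ0, map_smul, smul_apply]
  · rw [← hF0]; exact hΦ0 f x
  · obtain ⟨C, hC, h⟩ := hdec V hV
    refine ⟨C, hC, fun f γ κ x => ?_⟩
    have := h f γ κ x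
    rw [← hΦ] at this
    exact this

end

/-! ### Schatten classes -/

lemma rank_comp_lt {E F : Type*} [AddCommGroup E] [Module ℂ E] [AddCommGroup F] [Module ℂ F]
    {n j : ℕ} (hn : n < j) (Q : E →ₗ[ℂ] (Fin n → ℂ))
    (R : (Fin n → ℂ) →ₗ[ℂ] F) : (R ∘ₗ Q).rank < (j : Cardinal) := by
  have h1 : Module.finrank ℂ (LinearMap.range R) ≤ n :=
    (LinearMap.finrank_range_le R).trans (by simp)
  have h2 : LinearMap.rank (R ∘ₗ Q) ≤ LinearMap.rank R := LinearMap.rank_comp_le_left Q R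
  refine h2.trans_lt ?_
  rw [LinearMap.rank, ← Module.finrank_eq_rank]
  exact_mod_cast h1.trans_lt hn

section Schatten

variable {B₁ B₂ : Type*} [AddCommGroup B₁] [Module ℂ B₁] [QuasiBanachSpace B₁]
  [AddCommGroup B₂] [Module ℂ B₂] [QuasiBanachSpace B₂]

lemma opNorm_le_ofReal {T : B₁ →ₗ[ℂ] B₂} {C : ℝ} (hC : 0 ≤ C) (h : ∀ f, ‖T f‖ ≤ C * ‖f‖) :
    opNorm T ≤ ENNReal.ofReal C := by
  refine iSup₂_le fun f hf => ENNReal.ofReal_le_ofReal ((h f).trans ?_)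
  exact mul_le_of_le_one_right hC hf

lemma singularValue_le_of_rank_lt {T T₀ : B₁ →ₗ[ℂ] B₂} {j : ℕ} (h : T₀.rank < (j : Cardinal)) :
    singularValue j T ≤ opNorm (T - T₀) := iInf₂_le T₀ h

lemma singularValue_le_opNorm {T : B₁ →ₗ[ℂ] B₂} {j : ℕ} (hj : 0 < j) :
    singularValue j T ≤ opNorm T := by
  refine (singularValue_le_of_rank_lt (T₀ := 0) ?_).trans (by rw [sub_zero])
  rw [LinearMap.rank_zero]
  exact_mod_cast hj

lemma singularValue_anti (T : B₁ →ₗ[ℂ] B₂) {i j : ℕ} (hij : i ≤ j) :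
    singularValue j T ≤ singularValue i T :=
  le_iInf₂ fun _ h => singularValue_le_of_rank_lt (h.trans_le (by exact_mod_cast hij))

/-- Rapidly decaying singular values are `p`-summable for all `p`. -/
lemma memSchatten_of_rapidDecay {T : B₁ →ₗ[ℂ] B₂} {D : ℕ} (hD : 0 < D)
    (h : ∀ r : ℕ, ∃ C : ℝ, 0 ≤ C ∧ ∀ N : ℕ, 0 < N →
      singularValue (N ^ D) T ≤ ENNReal.ofReal (C / (N : ℝ) ^ r))
    {p : ℝ≥0∞} (hp : 0 < p) : MemSchatten p T := by
  -- `N` is the integer part of the `D`-th root of `j + 1`; then `j + 1 < (N + 1) ^ D ≤ (2 * N) ^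
  -- D`.
  have hroot : ∀ j : ℕ, ∃ N : ℕ, 0 < N ∧ N ^ D ≤ j + 1 ∧ j + 1 ≤ (2 * N) ^ D := by
    intro j
    have hex : ∃ M : ℕ, j + 1 < M ^ D :=
      ⟨j + 2, (Nat.lt_succ_self _).trans_le (Nat.le_self_pow hD.ne' _)⟩
    have hM := Nat.find_spec hex
    have hM2 : 2 ≤ Nat.find hex := by
      by_contra! hlt
      have h1 : Nat.find hex ^ D ≤ 1 := (Nat.pow_le_pow_left (Nat.lt_succ_iff.1 hlt) D).trans (by simp)
      omega
    refine ⟨Nat.find hex - 1, by omega, ?_, hM.le.trans (Nat.pow_le_pow_left (by omega) D)⟩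
    have := Nat.find_min hex (m := Nat.find hex - 1) (by omega)
    omega
  have hdecay : ∀ t : ℕ, ∃ C : ℝ, 0 ≤ C ∧ ∀ j : ℕ,
      singularValue (j + 1) T ≤ ENNReal.ofReal (C / ((j : ℝ) + 1) ^ t) := by
    intro t
    -- Since `N ^ D` is comparable with `j + 1` up to `2 ^ D`, decay of order `D * t` in `N` is
    -- decay of order `t` in `j`.
    obtain ⟨C, hC, hN⟩ := h (D * t)
    refine ⟨C * 2 ^ (D * t), by positivity, fun j => ?_⟩
    obtain ⟨N, hN0, hle, hge⟩ := hroot j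
    refine (singularValue_anti T hle).trans ((hN N hN0).trans (ENNReal.ofReal_le_ofReal ?_))
    have hN' : (0 : ℝ) < N := by exact_mod_cast hN0
    rw [div_le_div_iff₀ (by positivity) (by positivity), mul_assoc]
    refine mul_le_mul_of_nonneg_left ?_ hC
    rw [← mul_pow, pow_mul]
    refine pow_le_pow_left₀ (by positivity) ?_ t
    exact_mod_cast hge
  unfold MemSchatten schattenNorm
  split_ifs with hpt
  · obtain ⟨C, hC, hj⟩ := hdecay 0
    refine (iSup_le fun j => ?_).trans_lt (ENNReal.ofReal_lt_top (r := C))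
    simpa using hj j
  · have hp' : 0 < p.toReal := ENNReal.toReal_pos hp.ne' hpt
    -- With `t * p > 2` the series is dominated by `∑ 1 / (j + 1) ^ 2`.
    obtain ⟨t, ht⟩ := exists_nat_gt (2 / p.toReal)
    rw [div_lt_iff₀ hp'] at ht
    obtain ⟨C, hC, hj⟩ := hdecay t
    refine ENNReal.rpow_lt_top_of_nonneg (by positivity) (ne_of_lt ?_)
    have hsum : Summable fun j : ℕ => C ^ p.toReal * (1 / ((j : ℝ) + 1) ^ 2) := by
      refine Summable.mul_left _ ?_
      exact_mod_cast (summable_nat_add_iff 1).2 (Real.summable_one_div_nat_pow.2 one_lt_two)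
    refine lt_of_le_of_lt (ENNReal.tsum_le_tsum fun j => ?_) hsum.tsum_ofReal_lt_top
    calc singularValue (j + 1) T ^ p.toReal
        ≤ ENNReal.ofReal (C / ((j : ℝ) + 1) ^ t) ^ p.toReal :=
          ENNReal.rpow_le_rpow (hj j) hp'.le
      _ = ENNReal.ofReal ((C / ((j : ℝ) + 1) ^ t) ^ p.toReal) :=
          ENNReal.ofReal_rpow_of_nonneg (by positivity) hp'.le
      _ ≤ _ := by
          refine ENNReal.ofReal_le_ofReal ?_
          rw [Real.div_rpow hC (by positivity), div_eq_mul_one_div]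
          refine mul_le_mul_of_nonneg_left ?_ (by positivity)
          refine one_div_le_one_div_of_le (by positivity) ?_
          rw [← Real.rpow_natCast, ← Real.rpow_natCast, ← Real.rpow_mul (by positivity)]
          refine Real.rpow_le_rpow_of_exponent_le (by linarith [Nat.cast_nonneg (α := ℝ) j]) ?_
          exact_mod_cast ht.le

end Schatten

/-! ### Operators with kernels in spaces of test functions -/

/-- The best constant in `WeightBound v · (A f)`, as a seminorm. -/
def weightSeminorm {d : ℕ} {B : Type*} [AddCommGroup B] [Module ℂ B]
    (v : (Fin d → ℕ) → (Fin d → ℕ) → ℝ) (hv : ∀ α β, 0 ≤ v α β) (L : B →ₗ[ℂ] 𝓢(RPt d, ℂ))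
    (hL : ∀ f, ∃ A, WeightBound v A (L f)) : Seminorm ℂ B :=
  Seminorm.of (fun f => ⨆ i : GSIndex d, v i.1 i.2.1 * (|monomialAt i.2.1 i.2.2| *
      ‖multiD i.1 (L f) i.2.2‖))
    (fun f g => by
      obtain ⟨A, hA⟩ := hL f
      obtain ⟨A', hA'⟩ := hL g
      refine ciSup_le fun i => ?_
      refine le_trans ?_ (add_le_add
        (le_ciSup (f := fun i : GSIndex d => v i.1 i.2.1 * (|monomialAt i.2.1 i.2.2| *
          ‖multiD i.1 (L f) i.2.2‖)) ⟨A, by rintro _ ⟨i, rfl⟩; exact hA _ _ _⟩ i)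
        (le_ciSup (f := fun i : GSIndex d => v i.1 i.2.1 * (|monomialAt i.2.1 i.2.2| *
          ‖multiD i.1 (L g) i.2.2‖)) ⟨A', by rintro _ ⟨i, rfl⟩; exact hA' _ _ _⟩ i))
      rw [← mul_add, ← mul_add, map_add, map_add, add_apply]
      have := hv i.1 i.2.1
      gcongr
      exact norm_add_le _ _)
    (fun c f => by
      rw [Real.mul_iSup_of_nonneg (norm_nonneg c)]
      congr 1
      ext i
      rw [map_smul, map_smul, smul_apply, norm_smul]
      ring)

section

variable {d : ℕ} {B : Type*} [AddCommGroup B] [Module ℂ B]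
    {v : (Fin d → ℕ) → (Fin d → ℕ) → ℝ} (hv : ∀ α β, 0 ≤ v α β) {L : B →ₗ[ℂ] 𝓢(RPt d, ℂ)}
    (hL : ∀ f, ∃ A, WeightBound v A (L f))

lemma weightBound_weightSeminorm (f : B) : WeightBound v (weightSeminorm v hv L hL f) (L f) := by
  intro α β x
  obtain ⟨A, hA⟩ := hL f
  exact le_ciSup (f := fun i : GSIndex d => v i.1 i.2.1 * (|monomialAt i.2.1 i.2.2| *
    ‖multiD i.1 (L f) i.2.2‖)) ⟨A, by rintro _ ⟨i, rfl⟩; exact hA _ _ _⟩ (α, β, x)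

lemma weightSeminorm_le {f : B} {A : ℝ} (hA : WeightBound v A (L f)) :
    weightSeminorm v hv L hL f ≤ A :=
  ciSup_le fun _ => hA _ _ _

end

/-- `k` maps `X` into a quasi-Banach space `B`, with continuity controlled by a weight at the end of
arbitrarily long chains of weights that start in `𝒱`. -/
def ControlledByChains {d : ℕ} {X B : Type*} [AddCommGroup X] [Module ℂ X]
    [AddCommGroup B] [Module ℂ B] [QuasiBanachSpace B]
    (toS : X →ₗ[ℂ] 𝓢(RPt d, ℂ)) (𝒱 : Set ((Fin d → ℕ) → (Fin d → ℕ) → ℝ)) (k : X →ₗ[ℂ] B) : Prop :=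
  ∀ q : ℕ, ∃ V : ℕ → (Fin d → ℕ) → (Fin d → ℕ) → ℝ, V 0 ∈ 𝒱 ∧
    (∀ n < q, ∃ C, 0 ≤ C ∧ Dominates C (V (n + 1)) (V n)) ∧
    (∀ n < q, ∀ α β, V (n + 1) α β ≠ 0 → V 0 α 0 ≠ 0) ∧
    ∃ C, 0 ≤ C ∧ ∀ φ A, 0 ≤ A → WeightBound (V q) A (toS φ) → ‖k φ‖ ≤ C * A

section

variable {d : ℕ} {B₁ B₂ : Type*} [AddCommGroup B₁] [Module ℂ B₁] [QuasiBanachSpace B₁]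
  [AddCommGroup B₂] [Module ℂ B₂] [QuasiBanachSpace B₂]
  {X : Type*} [AddCommGroup X] [Module ℂ X]
  {toS : X →ₗ[ℂ] 𝓢(RPt d, ℂ)} {𝒱 : Set ((Fin d → ℕ) → (Fin d → ℕ) → ℝ)}
  {k : X →ₗ[ℂ] B₂} {Φ : B₁ →ₗ[ℂ] X}

lemma exists_opNorm_bound (hk : ControlledByChains toS 𝒱 k)
    (hΦ : ∀ v ∈ 𝒱, ∃ C, 0 ≤ C ∧ ∀ f, WeightBound v (C * ‖f‖) (toS (Φ f))) :
    ∃ C, 0 ≤ C ∧ opNorm (k ∘ₗ Φ) ≤ ENNReal.ofReal C := by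
  obtain ⟨V, hV0, -, -, C, hC, h⟩ := hk 0
  obtain ⟨C', hC', h'⟩ := hΦ _ hV0
  refine ⟨C * C', by positivity, opNorm_le_ofReal (by positivity) fun f => ?_⟩
  rw [mul_assoc]
  exact h _ _ (mul_nonneg hC' (quasiNorm_nonneg f)) (h' f)

/-- Subtracting the finite-rank interpolation of the samples leaves a function with vanishing
samples, for which the chain gives `N ^ (-q)`; the factor `1 + 2 * n` is the price of the
interpolation. -/
lemma exists_singularValue_bound (h𝒱 : ∀ v ∈ 𝒱, ∀ α β, 0 ≤ v α β)
    (hk : ControlledByChains toS 𝒱 k)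
    (hΦ : ∀ v ∈ 𝒱, ∃ C, 0 ≤ C ∧ ∀ f, WeightBound v (C * ‖f‖) (toS (Φ f))) (q : ℕ) :
    ∃ C, 0 ≤ C ∧ ∀ N : ℕ, 0 < N → ∃ n ≤ (N + 1) ^ d * (2 * N ^ 2 + 1) ^ d,
      singularValue (n + 1) (k ∘ₗ Φ) ≤ ENNReal.ofReal (C * (1 + 2 * n) / N ^ q) := by
  obtain ⟨V, hV0, hchain, hsupp, Ck, hCk, hkV⟩ := hk q
  obtain ⟨CΦ, hCΦ, hΦV⟩ := hΦ _ hV0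
  obtain ⟨Cs, hCs, hs⟩ := exists_weightBound_of_chain hchain
  refine ⟨Ck * Cs * CΦ, by positivity, fun N hN => ?_⟩
  -- A true seminorm on `B₁`, dominated by the quasi-norm. The interpolation is carried out with
  -- respect to it.
  let ρ := weightSeminorm (V 0) (h𝒱 _ hV0) (toS ∘ₗ Φ) fun f => ⟨_, hΦV f⟩
  have hρ : ∀ f, WeightBound (V 0) (ρ f) (toS (Φ f)) := fun f =>
    weightBound_weightSeminorm (L := toS ∘ₗ Φ) (h𝒱 _ hV0) _ f
  have hρΦ : ∀ f, ρ f ≤ CΦ * ‖f‖ := fun f => weightSeminorm_le (L := toS ∘ₗ Φ) _ _ (hΦV f)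
  -- The factor `V 0 α 0` makes every sample bounded by `ρ` with constant `1`. Where it vanishes the
  -- sample is lost, but by `hsupp` the later weights of the chain vanish there too.
  let ℓ : (Fin d → Fin (N + 1)) × (Fin d → Fin (2 * N ^ 2 + 1)) → B₁ →ₗ[ℂ] ℂ := fun i =>
    { toFun := fun f => (V 0 (fun l => i.1 l) 0 : ℂ) *
        multiD (fun l => (i.1 l : ℕ)) (toS (Φ f)) (gridPoint N i.2)
      map_add' := fun f g => by simp only [map_add, add_apply, mul_add]
      map_smul' := fun c f => by
        simp only [map_smul, smul_apply, smul_eq_mul, RingHom.id_apply]; ring }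
  have hℓ : ∀ i f, ‖ℓ i f‖ ≤ 1 * ρ f := by
    intro i f
    have := hρ f (fun l => i.1 l) 0 (gridPoint N i.2)
    rw [monomialAt_zero, abs_one, one_mul] at this
    change ‖(V 0 (fun l => i.1 l) 0 : ℂ) * _‖ ≤ _
    rw [norm_mul, Complex.norm_real, Real.norm_of_nonneg (h𝒱 _ hV0 _ _), one_mul]
    exact this
  obtain ⟨n, hn, Q, R, hQR⟩ := exists_finiteRank_interpolation ρ ℓ hℓ
  refine ⟨n, by simpa using hn, ?_⟩
  refine (singularValue_le_of_rank_lt (T₀ := ((k ∘ₗ Φ) ∘ₗ R) ∘ₗ Q)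
    (rank_comp_lt (Nat.lt_succ_self n) Q ((k ∘ₗ Φ) ∘ₗ R))).trans ?_
  refine opNorm_le_ofReal (by positivity) fun f => ?_
  have hdiff : (k ∘ₗ Φ - ((k ∘ₗ Φ) ∘ₗ R) ∘ₗ Q) f = k (Φ (f - R (Q f))) := by
    simp only [LinearMap.sub_apply, LinearMap.comp_apply, map_sub]
  rw [hdiff]
  have hb := hs N hN (ρ (f - R (Q f))) (apply_nonneg ρ _) _ (hρ (f - R (Q f)))
    fun α hα ⟨m, hm, β, hβ⟩ a => by
      have h1 := (hQR f).1 (fun l => ⟨α l, Nat.lt_succ_iff.2 (hα l)⟩, a)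
      have h2 : (V 0 α 0 : ℂ) ≠ 0 := by exact_mod_cast hsupp m hm α β hβ
      exact (mul_eq_zero.1 h1).resolve_left h2
  have h3 := hkV _ _ (mul_nonneg (by positivity) (apply_nonneg ρ _)) hb
  calc _ ≤ Ck * (Cs / N ^ q * ρ (f - R (Q f))) := h3
    _ ≤ Ck * (Cs / N ^ q * ((1 + 2 * n) * (CΦ * ‖f‖))) := by
        gcongr
        exact (hQR f).2.trans (mul_le_mul_of_nonneg_left (hρΦ f) (by positivity))
    _ = _ := by ring

/-- The exponent is `2 * d` for the orders plus `4 * d` for the grid points; the additional `1`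
absorbs the `+ 1` on the left. -/
lemma sample_card_lt (d : ℕ) {N : ℕ} (hN : 2 ≤ N) :
    (N + 1) ^ d * (2 * N ^ 2 + 1) ^ d + 1 ≤ N ^ (6 * d + 1) := by
  have h1 : N + 1 ≤ N ^ 2 := by nlinarith
  have h2 : 2 * N ^ 2 + 1 ≤ N ^ 4 := by
    have : 2 ^ 2 ≤ N ^ 2 := Nat.pow_le_pow_left hN 2
    have h4 : N ^ 4 = N ^ 2 * N ^ 2 := by ring
    nlinarith
  have h3 : (N + 1) ^ d * (2 * N ^ 2 + 1) ^ d ≤ N ^ (6 * d) := by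
    calc _ ≤ (N ^ 2) ^ d * (N ^ 4) ^ d :=
          Nat.mul_le_mul (Nat.pow_le_pow_left h1 d) (Nat.pow_le_pow_left h2 d)
      _ = _ := by rw [← mul_pow, ← pow_add, ← pow_mul]
  have h4 : 1 ≤ N ^ (6 * d) := Nat.one_le_pow _ _ (by omega)
  calc _ ≤ N ^ (6 * d) + N ^ (6 * d) := by omega
    _ = N ^ (6 * d) * 2 := by ring
    _ ≤ N ^ (6 * d) * N := Nat.mul_le_mul_left _ hN
    _ = _ := (pow_succ _ _).symm

/-- An operator that factors through a space of test functions belongs to all Schatten classes. -/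
theorem memSchatten_of_chains (h𝒱 : ∀ v ∈ 𝒱, ∀ α β, 0 ≤ v α β)
    (hk : ControlledByChains toS 𝒱 k)
    (hΦ : ∀ v ∈ 𝒱, ∃ C, 0 ≤ C ∧ ∀ f, WeightBound v (C * ‖f‖) (toS (Φ f)))
    {p : ℝ≥0∞} (hp : 0 < p) : MemSchatten p (k ∘ₗ Φ) := by
  refine memSchatten_of_rapidDecay (D := 6 * d + 1) (Nat.succ_pos _) (fun r => ?_) hp
  obtain ⟨C₁, hC₁, h₁⟩ := exists_opNorm_bound hk hΦ
  -- The surplus `6 * d + 1` in the chain length cancels `1 + 2 * n ≤ 3 * N ^ (6 * d + 1)`.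
  obtain ⟨C, hC, h⟩ := exists_singularValue_bound h𝒱 hk hΦ (r + (6 * d + 1))
  refine ⟨C₁ + C * 3, by positivity, fun N hN => ?_⟩
  have hN' : (0 : ℝ) < N := by exact_mod_cast hN
  -- The count of samples needs `N ≥ 2`; for `N = 1` the operator norm is enough.
  rcases Nat.lt_or_ge N 2 with hN2 | hN2
  · obtain rfl : N = 1 := by omega
    refine (singularValue_le_opNorm (Nat.pow_pos one_pos)).trans
      (h₁.trans (ENNReal.ofReal_le_ofReal ?_))
    simp; positivity
  obtain ⟨n, hn, hs⟩ := h N hN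
  have hcard := sample_card_lt d hN2
  refine (singularValue_anti _ (by omega : n + 1 ≤ N ^ (6 * d + 1))).trans
    (hs.trans (ENNReal.ofReal_le_ofReal ?_))
  have hn' : (n : ℝ) + 1 ≤ (N : ℝ) ^ (6 * d + 1) := by
    exact_mod_cast (by omega : n + 1 ≤ N ^ (6 * d + 1))
  rw [pow_add, ← div_div, div_le_div_iff₀ (by positivity) (by positivity), div_mul_cancel₀ _ (by positivity)]
  calc C * (1 + 2 * n) ≤ C * (3 * (N : ℝ) ^ (6 * d + 1)) := by
        gcongr
        have : (0 : ℝ) ≤ n := Nat.cast_nonneg n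
        linarith
    _ ≤ _ := by
        have : 0 ≤ C₁ * (N : ℝ) ^ (6 * d + 1) := by positivity
        linarith

end

/-- Operators with kernels in a space of test functions belong to all Schatten classes. -/
theorem exists_kernelOperator {d₁ d₂ : ℕ} {B₁ B₂ : Type*} [AddCommGroup B₁] [Module ℂ B₁]
    [QuasiBanachSpace B₁] [AddCommGroup B₂] [Module ℂ B₂] [QuasiBanachSpace B₂]
    {X₁ : Type*} [AddCommGroup X₁] [Module ℂ X₁] [TopologicalSpace X₁]
    {X₂ : Type*} [AddCommGroup X₂] [Module ℂ X₂] [TopologicalSpace X₂]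
    {toS₁ : X₁ →ₗ[ℂ] 𝓢(RPt d₁, ℂ)} {toS₂ : X₂ →ₗ[ℂ] 𝓢(RPt d₂, ℂ)}
    {𝒱₁ : Set ((Fin d₁ → ℕ) → (Fin d₁ → ℕ) → ℝ)} {𝒱₂ : Set ((Fin d₂ → ℕ) → (Fin d₂ → ℕ) → ℝ)}
    (h₁ : IsTestSpace toS₁ 𝒱₁) (h₂ : IsTestSpace toS₂ 𝒱₂) {K : 𝓢(RPt (d₂ + d₁), ℂ)}
    (hK : ∀ V ∈ 𝒱₂, ∀ v ∈ 𝒱₁, ∃ A, KernelBound V v A K)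
    {j : B₁ →ₗ[ℂ] StrongDual ℂ X₁} (hj : Continuous j)
    {slice : RPt d₂ → X₁} (hslice : ∀ x, toS₁ (slice x) = sliceS x K)
    {k : X₂ →ₗ[ℂ] B₂} (hk : ControlledByChains toS₂ 𝒱₂ k) :
    ∃ T : B₁ →ₗ[ℂ] B₂, IsKernelOperator toS₂ j k slice T ∧
      ∀ p : ℝ≥0∞, 0 < p → MemSchatten p T := by
  obtain ⟨Φ, hΦ, hbd⟩ := exists_kernelTransform h₁ h₂ hK hj hslice
  exact ⟨k ∘ₗ Φ, fun f => ⟨Φ f, hΦ f, rfl⟩, fun p hp => memSchatten_of_chains h₂.nonneg hk hbd hp⟩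

/-! ### Gelfand-Shilov weights -/

/-- The weight `(h^{|α|+|β|} (α! β!)^s)⁻¹` of the `S_{s,h}`-norm. -/
def invWeight (d : ℕ) (s h : ℝ) (α β : Fin d → ℕ) : ℝ := (gsWeight s h α β)⁻¹

lemma invWeight_pos {d : ℕ} (s : ℝ) {h : ℝ} (hh : 0 < h) (α β : Fin d → ℕ) :
    0 < invWeight d s h α β := inv_pos.2 (gsWeight_pos s hh α β)

lemma gsTerm_eq_invWeight {d : ℕ} (s h : ℝ) (f : 𝓢(RPt d, ℂ)) (i : GSIndex d) :
    gsTerm s h f i = invWeight d s h i.1 i.2.1 * (|monomialAt i.2.1 i.2.2| *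
      ‖multiD i.1 f i.2.2‖) := by
  rw [gsTerm, invWeight, div_eq_inv_mul]

lemma mem_gsStepSubmodule_iff {d : ℕ} {s : ℝ} {h : Set.Ioi (0 : ℝ)} {f : 𝓢(RPt d, ℂ)} :
    f ∈ gsStepSubmodule s h d ↔ ∃ A, WeightBound (invWeight d s h) A f := by
  constructor
  · rintro ⟨A, hA⟩
    refine ⟨A, fun α β x => ?_⟩
    have := hA ⟨(α, β, x), rfl⟩
    rwa [gsTerm_eq_invWeight] at this
  · rintro ⟨A, hA⟩
    refine ⟨A, ?_⟩
    rintro _ ⟨i, rfl⟩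
    rw [gsTerm_eq_invWeight]
    exact hA _ _ _

lemma GSStep.norm_le {d : ℕ} {s : ℝ} {h : Set.Ioi (0 : ℝ)} {f : GSStep s h d} {A : ℝ}
    (hf : WeightBound (invWeight d s h) A f.1) : ‖f‖ ≤ A := by
  rw [GSStep.norm_def]
  refine ciSup_le fun i => ?_
  rw [gsTerm_eq_invWeight]
  exact hf _ _ _

/-- A function with a bound as an element of `S_{s,h}`. -/
def GSStep.of {d : ℕ} {s : ℝ} {h : Set.Ioi (0 : ℝ)} (f : 𝓢(RPt d, ℂ))
    (hf : ∃ A, WeightBound (invWeight d s h) A f) : GSStep s h d :=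
  ⟨f, mem_gsStepSubmodule_iff.2 hf⟩

lemma multiFactorial_add_unitIndex {d : ℕ} (β : Fin d → ℕ) (i : Fin d) :
    multiFactorial (β + unitIndex i) = (β i + 1) * multiFactorial β := by
  unfold multiFactorial
  rw [← Finset.mul_prod_erase _ _ (Finset.mem_univ i),
    ← Finset.mul_prod_erase (a := i) _ (fun j => (β j).factorial) (Finset.mem_univ i), ← mul_assoc]
  congr 1
  · simp [Nat.factorial_succ]
  · refine Finset.prod_congr rfl fun j hj => ?_
    simp [Finset.ne_of_mem_erase hj]

lemma gsWeight_raise {d : ℕ} (s h : ℝ) (α β : Fin d → ℕ) (i : Fin d) :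
    gsWeight s h α (β + unitIndex i) = gsWeight s h α β * (h * ((β i : ℝ) + 1) ^ s) := by
  unfold gsWeight
  rw [multiLength_add, multiLength_unitIndex, multiFactorial_add_unitIndex, ← add_assoc, pow_succ]
  push_cast
  rw [mul_left_comm (multiFactorial α : ℝ), Real.mul_rpow (by positivity) (by positivity)]
  ring

lemma gsWeight_swap {d : ℕ} (s h : ℝ) (α β : Fin d → ℕ) :
    gsWeight s h α β = gsWeight s h β α := by
  unfold gsWeight
  rw [add_comm, mul_comm (multiFactorial α)]

lemma gsWeight_two_mul {d : ℕ} (s h : ℝ) (α β : Fin d → ℕ) :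
    gsWeight s (2 * h) α β = 2 ^ (multiLength α + multiLength β) * gsWeight s h α β := by
  unfold gsWeight
  rw [mul_pow, mul_assoc]

/-- Lets the factor `2 ^ (|α| + |β|)` gained by doubling `h` absorb the factorial quotient `(β_i +
1) ^ s`. -/
lemma exists_rpow_le_two_pow (s : ℝ) : ∃ C : ℝ, 0 ≤ C ∧ ∀ n : ℕ, ((n : ℝ) + 1) ^ s ≤ C * 2 ^ n := by
  obtain ⟨m, hm⟩ := exists_nat_ge s
  have h1 : Tendsto (fun n : ℕ => ((n + 1 : ℕ) : ℝ) ^ m * (1 / 2 : ℝ) ^ (n + 1)) atTop (𝓝 0) :=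
    (tendsto_add_atTop_iff_nat (f := fun n : ℕ => (n : ℝ) ^ m * (1 / 2 : ℝ) ^ n) 1).2
      (tendsto_pow_const_mul_const_pow_of_lt_one m (by norm_num) (by norm_num))
  obtain ⟨C, hC⟩ := h1.bddAbove_range
  refine ⟨2 * |C|, by positivity, fun n => ?_⟩
  have h2 := hC ⟨n, rfl⟩
  dsimp only at h2
  rw [one_div, inv_pow, ← div_eq_mul_inv, div_le_iff₀ (by positivity)] at h2
  calc ((n : ℝ) + 1) ^ s ≤ ((n : ℝ) + 1) ^ (m : ℝ) :=
        Real.rpow_le_rpow_of_exponent_le (by linarith [Nat.cast_nonneg (α := ℝ) n]) hm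
    _ = ((n + 1 : ℕ) : ℝ) ^ m := by rw [Real.rpow_natCast]; push_cast; rfl
    _ ≤ C * 2 ^ (n + 1) := h2
    _ ≤ |C| * 2 ^ (n + 1) := mul_le_mul_of_nonneg_right (le_abs_self C) (by positivity)
    _ = _ := by ring

/-- Doubling `h` gains `2 ^ (|α| + |β|)`, which outweighs both the polynomial factors `α_i`, `β_i`
and the change of the factorials when an index is raised. -/
lemma exists_dominates_invWeight (d : ℕ) {s h : ℝ} (hs : 0 ≤ s) (hh : 0 < h) :
    ∃ C, 0 ≤ C ∧ Dominates C (invWeight d s (2 * h)) (invWeight d s h) := by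
  obtain ⟨C, hC, hpow⟩ := exists_rpow_le_two_pow s
  have hraise : ∀ (α β : Fin d → ℕ) (i : Fin d), invWeight d s (2 * h) α β
      ≤ (h * C + 1 / h + 1) * invWeight d s h α (β + unitIndex i) := by
    intro α β i
    have hw := gsWeight_pos s hh α β
    unfold invWeight
    rw [gsWeight_raise, gsWeight_two_mul, ← div_eq_mul_inv, le_div_iff₀ (by positivity),
      inv_mul_le_iff₀ (by positivity)]
    have h1 : ((β i : ℝ) + 1) ^ s ≤ C * 2 ^ (multiLength α + multiLength β) :=
      (hpow (β i)).trans (mul_le_mul_of_nonneg_left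
        (pow_le_pow_right₀ one_le_two ((le_multiLength β i).trans (Nat.le_add_left _ _))) hC)
    calc gsWeight s h α β * (h * ((β i : ℝ) + 1) ^ s)
        ≤ gsWeight s h α β * (h * (C * 2 ^ (multiLength α + multiLength β))) := by gcongr
      _ = 2 ^ (multiLength α + multiLength β) * gsWeight s h α β * (h * C) := by ring
      _ ≤ _ := by
          refine mul_le_mul_of_nonneg_left ?_ (by positivity)
          have : 0 ≤ 1 / h := by positivity
          linarith
  have hfreq : ∀ (α β : Fin d → ℕ) (n : ℕ), n ≤ multiLength α + multiLength β →
      (n : ℝ) * invWeight d s (2 * h) α β ≤ invWeight d s h α β := by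
    intro α β n hn
    have hw := gsWeight_pos s hh α β
    unfold invWeight
    rw [gsWeight_two_mul, mul_inv, ← mul_assoc]
    refine mul_le_of_le_one_left (by positivity) ?_
    rw [← div_eq_mul_inv, div_le_one (by positivity)]
    have : n ≤ 2 ^ (multiLength α + multiLength β) := hn.trans Nat.lt_two_pow_self.le
    exact_mod_cast this
  have hsymm : ∀ (h : ℝ) (α β : Fin d → ℕ), invWeight d s h α β = invWeight d s h β α :=
    fun h α β => by unfold invWeight; rw [gsWeight_swap]
  -- The summand `h * C` serves `raise` and, by symmetry in `α` and `β`, `deriv`; `1 / h` serves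
  -- `lower`; and `1` serves `freq` and the case of `lower` where `β i = 0` and nothing is
  -- subtracted.
  refine ⟨h * C + 1 / h + 1, by positivity, fun α β => (invWeight_pos s (by positivity) α β).le,
    hraise, fun α β i => ?_, fun α β i => ?_, fun α β i => ?_⟩
  · rw [hsymm, hsymm h]; exact hraise β α i
  · refine (hfreq α β (β i) ((le_multiLength β i).trans (Nat.le_add_left _ _))).trans ?_
    have hpos := invWeight_pos s hh α (β - unitIndex i)
    have hhC : 0 ≤ h * C := by positivity
    have hh1 : 0 < 1 / h := by positivity
    rcases Nat.eq_zero_or_pos (β i) with h0 | h0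
    · have : β - unitIndex i = β := by
        ext k
        by_cases hk : k = i
        · subst hk; simp [h0]
        · simp [hk]
      rw [this] at hpos ⊢
      exact le_mul_of_one_le_left hpos.le (by linarith)
    · have hβ : β = (β - unitIndex i) + unitIndex i := by
        ext k
        by_cases hk : k = i
        · subst hk; simp; omega
        · simp [hk]
      have hw := gsWeight_pos s hh α (β - unitIndex i)
      calc invWeight d s h α β
          = invWeight d s h α (β - unitIndex i) *
            (h * (((β - unitIndex i) i : ℕ) + 1 : ℝ) ^ s)⁻¹ := by
            conv_lhs => rw [hβ]
            unfold invWeight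
            rw [gsWeight_raise, mul_inv]
        _ ≤ invWeight d s h α (β - unitIndex i) * (1 / h) := by
            refine mul_le_mul_of_nonneg_left ?_ hpos.le
            rw [← one_div]
            refine one_div_le_one_div_of_le hh (le_mul_of_one_le_right hh.le ?_)
            exact Real.one_le_rpow (by linarith [Nat.cast_nonneg (α := ℝ) ((β - unitIndex i) i)]) hs
        _ ≤ _ := by
            rw [mul_comm]
            refine mul_le_mul_of_nonneg_right (by linarith) hpos.le
  · refine (hfreq α β (α i) ((le_multiLength α i).trans (Nat.le_add_right _ _))).trans ?_
    have hpos := invWeight_pos s hh α β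
    have : 0 ≤ h * C := by positivity
    have : 0 < 1 / h := by positivity
    exact le_mul_of_one_le_left hpos.le (by linarith)

/-! ### Products -/

lemma multiLength_append {m n : ℕ} (γ : Fin m → ℕ) (α : Fin n → ℕ) :
    multiLength (Fin.append γ α) = multiLength γ + multiLength α := by
  simp [multiLength, Fin.sum_univ_add]

lemma multiFactorial_append {m n : ℕ} (γ : Fin m → ℕ) (α : Fin n → ℕ) :
    multiFactorial (Fin.append γ α) = multiFactorial γ * multiFactorial α := by
  simp [multiFactorial, Fin.prod_univ_add]

lemma monomialAt_append {m n : ℕ} (κ : Fin m → ℕ) (β : Fin n → ℕ) (x : RPt m) (y : RPt n) :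
    monomialAt (Fin.append κ β) (pairPt x y) = monomialAt κ x * monomialAt β y := by
  simp [monomialAt, Fin.prod_univ_add, pairPt_castAdd, pairPt_natAdd]

/-- Factorials and lengths split over the two groups of variables, so a bound for `K` on the product
is exactly a bound in both variables at once. -/
lemma invWeight_append {m n : ℕ} (s h : ℝ) (γ κ : Fin m → ℕ) (α β : Fin n → ℕ) :
    invWeight (m + n) s h (Fin.append γ α) (Fin.append κ β)
      = invWeight m s h γ κ * invWeight n s h α β := by
  unfold invWeight gsWeight
  rw [← mul_inv, multiLength_append, multiLength_append, multiFactorial_append,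
    multiFactorial_append]
  push_cast
  rw [show (multiFactorial γ * multiFactorial α * (multiFactorial κ * multiFactorial β) : ℝ)
    = (multiFactorial γ * multiFactorial κ) * (multiFactorial α * multiFactorial β) by ring,
    Real.mul_rpow (by positivity) (by positivity)]
  ring

lemma invWeight_anti {d : ℕ} (s : ℝ) {h h' : ℝ} (hh : 0 < h) (hle : h ≤ h') (α β : Fin d → ℕ) :
    invWeight d s h' α β ≤ invWeight d s h α β := by
  unfold invWeight
  refine inv_anti₀ (gsWeight_pos s hh α β) ?_
  unfold gsWeight
  gcongr

lemma kernelBound_of_weightBound {d₁ d₂ : ℕ} {V : (Fin d₂ → ℕ) → (Fin d₂ → ℕ) → ℝ}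
    {v : (Fin d₁ → ℕ) → (Fin d₁ → ℕ) → ℝ} {w : (Fin (d₂ + d₁) → ℕ) → (Fin (d₂ + d₁) → ℕ) → ℝ}
    (hw : ∀ γ κ α β, V γ κ * v α β ≤ w (Fin.append γ α) (Fin.append κ β)) {A : ℝ}
    {K : 𝓢(RPt (d₂ + d₁), ℂ)} (hK : WeightBound w A K) : KernelBound V v A K := by
  intro γ κ x α β y
  refine le_trans ?_ (hK (Fin.append γ α) (Fin.append κ β) (pairPt x y))
  rw [monomialAt_append, abs_mul]
  exact mul_le_mul_of_nonneg_right (hw γ κ α β) (by positivity)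

lemma kernelBound_invWeight {d₁ d₂ : ℕ} {s h h₁ h₂ : ℝ} (hh : 0 < h) (hh₁ : h ≤ h₁) (hh₂ : h ≤ h₂)
    {A : ℝ} {K : 𝓢(RPt (d₂ + d₁), ℂ)} (hK : WeightBound (invWeight (d₂ + d₁) s h) A K) :
    KernelBound (invWeight d₂ s h₂) (invWeight d₁ s h₁) A K := by
  refine kernelBound_of_weightBound (fun γ κ α β => ?_) hK
  rw [invWeight_append]
  exact mul_le_mul (invWeight_anti s hh hh₂ γ κ) (invWeight_anti s hh hh₁ α β)
    (invWeight_pos s (hh.trans_le hh₁) α β).le (invWeight_pos s hh γ κ).le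

/-! ### Maps from test functions into quasi-Banach spaces -/

lemma exists_bound_of_unit_bound {d : ℕ} {X B : Type*} [AddCommGroup X] [Module ℂ X]
    [AddCommGroup B] [Module ℂ B] [QuasiBanachSpace B] {toS : X →ₗ[ℂ] 𝓢(RPt d, ℂ)}
    {v : (Fin d → ℕ) → (Fin d → ℕ) → ℝ} {k : X →ₗ[ℂ] B} {r : ℝ} (hr : 0 < r)
    (hk : ∀ φ, WeightBound v r (toS φ) → ‖k φ‖ < 1) :
    ∃ C, 0 ≤ C ∧ ∀ φ A, 0 ≤ A → WeightBound v A (toS φ) → ‖k φ‖ ≤ C * A := by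
  refine ⟨1 / r, by positivity, fun φ A hA hφ => ?_⟩
  refine le_of_forall_gt_imp_ge_of_dense fun t ht => ?_
  have ht0 : 0 < t := lt_of_le_of_lt (by positivity) ht
  have h1 := hk (((1 / t : ℝ) : ℂ) • φ) fun α β x => by
    rw [map_smul, map_smul, smul_apply, norm_smul, Complex.norm_real,
      Real.norm_of_nonneg (by positivity)]
    rw [one_div_mul_eq_div, div_lt_iff₀ hr] at ht
    calc _ = (v α β * (|monomialAt β x| * ‖multiD α (toS φ) x‖)) / t := by ring
      _ ≤ A / t := div_le_div_of_nonneg_right (hφ α β x) ht0.le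
      _ ≤ r := by rw [div_le_iff₀ ht0]; linarith
  rw [map_smul, quasiNorm_real_smul (by positivity), one_div_mul_eq_div, div_lt_one ht0] at h1
  exact h1.le

lemma unitBall_preimage_mem_nhds {X B : Type*} [AddCommGroup X] [Module ℂ X] [TopologicalSpace X]
    [AddCommGroup B] [Module ℂ B] [QuasiBanachSpace B] {k : X →ₗ[ℂ] B} (hk : Continuous k) :
    {φ | ‖k φ‖ < 1} ∈ 𝓝 (0 : X) :=
  hk.continuousAt.preimage_mem_nhds (by rw [map_zero]; exact quasiBall_mem_nhds_zero one_pos)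

/-- The chain `h, 2h, 4h, …` of Gelfand-Shilov weights. -/
lemma invWeight_chain (d : ℕ) {s h : ℝ} (hs : 0 ≤ s) (hh : 0 < h) (q : ℕ) :
    (∀ n < q, ∃ C, 0 ≤ C ∧
      Dominates C (invWeight d s (2 ^ (n + 1) * h)) (invWeight d s (2 ^ n * h))) ∧
    (∀ n < q, ∀ α β, invWeight d s (2 ^ (n + 1) * h) α β ≠ 0 → invWeight d s (2 ^ 0 * h) α 0 ≠ 0) := by
  refine ⟨fun n _ => ?_, fun n _ α β _ => (invWeight_pos s (by positivity) α 0).ne'⟩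
  rw [pow_succ', mul_assoc]
  exact exists_dominates_invWeight d hs (by positivity)

/-! ### The Roumieu case -/

/-- The inclusion `S_s → 𝓢` as a linear map. -/
def GS.toSchwartzLin (s : ℝ) (d : ℕ) : GS s d →ₗ[ℂ] 𝓢(RPt d, ℂ) where
  toFun := GS.toSchwartz
  map_add' _ _ := rfl
  map_smul' _ _ := rfl

lemma GSStep.continuous_toGS {s : ℝ} {d : ℕ} (h : Set.Ioi (0 : ℝ)) :
    Continuous (GSStep.toGS h : GSStep s h d → GS s d) :=
  continuous_iff_coinduced_le.2
    (le_iSup (fun h : Set.Ioi (0 : ℝ) => TopologicalSpace.coinduced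
      (GSStep.toGS h : GSStep s h d → GS s d) inferInstance) h)

/-- The inclusion `S_{s,h} → S_s` as a continuous linear map. -/
def GSStep.toGSCLM {s : ℝ} {d : ℕ} (h : Set.Ioi (0 : ℝ)) : GSStep s h d →L[ℂ] GS s d where
  toFun := GSStep.toGS h
  map_add' _ _ := rfl
  map_smul' _ _ := rfl
  cont := GSStep.continuous_toGS h

/-- One step `S_{s,h}` suffices, with `h` later taken from the kernel: its balls map to bounded sets
under the continuous inclusion, so bounded sets of the inductive limit need no description. -/
lemma GS.isTestSpace (s : ℝ) (d : ℕ) (h : Set.Ioi (0 : ℝ)) :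
    IsTestSpace (GS.toSchwartzLin s d) {invWeight d s h} where
  injective := Subtype.val_injective
  exists_of_bound ψ hψ := ⟨⟨ψ, h, mem_gsStepSubmodule_iff.2 (hψ _ rfl)⟩, rfl⟩
  nonneg := by rintro _ rfl α β; exact (invWeight_pos s h.2 α β).le
  exists_pos α β := ⟨_, rfl, invWeight_pos s h.2 α β⟩
  isVonNBounded S hS := by
    obtain ⟨A, hA⟩ := hS _ rfl
    refine ((NormedSpace.isVonNBounded_closedBall ℂ (GSStep s h d) A).image
      (GSStep.toGSCLM h)).subset fun φ hφ => ?_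
    exact ⟨GSStep.of φ.toSchwartz ⟨A, hA φ hφ⟩,
      mem_closedBall_zero_iff.2 (GSStep.norm_le (hA φ hφ)), rfl⟩

lemma GS.controlledByChains {s : ℝ} (hs : 0 ≤ s) {d : ℕ} (h : Set.Ioi (0 : ℝ)) {B : Type*}
    [AddCommGroup B] [Module ℂ B] [QuasiBanachSpace B] {k : GS s d →ₗ[ℂ] B} (hk : Continuous k) :
    ControlledByChains (GS.toSchwartzLin s d) {invWeight d s h} k := by
  intro q
  have hh : 0 < (h : ℝ) := h.2
  obtain ⟨hc1, hc2⟩ := invWeight_chain d hs hh q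
  refine ⟨fun n => invWeight d s (2 ^ n * h), by simp, hc1, hc2, ?_⟩
  -- The end of the chain is still a step of `S_s`, and `k` is continuous on every step.
  let h' : Set.Ioi (0 : ℝ) := ⟨2 ^ q * h, by simpa using hh⟩
  have hnhds := (GSStep.continuous_toGS (s := s) (d := d) h').continuousAt.preimage_mem_nhds
    (x := 0) (unitBall_preimage_mem_nhds hk)
  obtain ⟨r, hr, hball⟩ := Metric.mem_nhds_iff.1 hnhds
  refine exists_bound_of_unit_bound (r := r / 2) (by positivity) fun φ hφ => ?_
  exact hball (a := GSStep.of φ.toSchwartz ⟨_, hφ⟩)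
    (mem_ball_zero_iff.2 ((GSStep.norm_le hφ).trans_lt (half_lt_self hr)))

/-! ### The Beurling case -/

/-- The inclusion `Σ_s → 𝓢` as a linear map. -/
def GSSigma.toSchwartzLin (s : ℝ) (d : ℕ) : GSSigma s d →ₗ[ℂ] 𝓢(RPt d, ℂ) where
  toFun := GSSigma.toSchwartz
  map_add' _ _ := rfl
  map_smul' _ _ := rfl

/-- The inclusion `Σ_s → S_{s,h}` as a linear map. -/
def GSSigma.toStepLin {s : ℝ} {d : ℕ} (h : Set.Ioi (0 : ℝ)) : GSSigma s d →ₗ[ℂ] GSStep s h d where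
  toFun := GSSigma.toStep h
  map_add' _ _ := rfl
  map_smul' _ _ := rfl

/-- The norms of `Σ_s`. -/
def GSSigma.stepSeminorms (s : ℝ) (d : ℕ) :
    SeminormFamily ℂ (GSSigma s d) (Σ _ : Set.Ioi (0 : ℝ), Fin 1) :=
  SeminormFamily.sigma fun h =>
    SeminormFamily.comp (fun _ : Fin 1 => normSeminorm ℂ (GSStep s h d)) (GSSigma.toStepLin h)

lemma GSSigma.withSeminorms (s : ℝ) (d : ℕ) : WithSeminorms (GSSigma.stepSeminorms s d) :=
  withSeminorms_iInf fun h =>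
    LinearMap.withSeminorms_induced (norm_withSeminorms ℂ (GSStep s h d)) (GSSigma.toStepLin h)

lemma GSSigma.stepSeminorms_le {s : ℝ} {d : ℕ} {h : Set.Ioi (0 : ℝ)} (n : Fin 1) {φ : GSSigma s d}
    {A : ℝ} (hφ : WeightBound (invWeight d s h) A φ.toSchwartz) :
    GSSigma.stepSeminorms s d ⟨h, n⟩ φ ≤ A :=
  GSStep.norm_le (f := GSSigma.toStep h φ) hφ

lemma GSSigma.isTestSpace (s : ℝ) (d : ℕ) :
    IsTestSpace (GSSigma.toSchwartzLin s d) {v | ∃ h > 0, v = invWeight d s h} where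
  injective := Subtype.val_injective
  exists_of_bound ψ hψ := ⟨⟨ψ, (Submodule.mem_iInf _).2 fun h =>
    mem_gsStepSubmodule_iff.2 (hψ _ ⟨h, h.2, rfl⟩)⟩, rfl⟩
  nonneg := by rintro _ ⟨h, hh, rfl⟩ α β; exact (invWeight_pos s hh α β).le
  exists_pos α β := ⟨_, ⟨1, one_pos, rfl⟩, invWeight_pos s one_pos α β⟩
  isVonNBounded S hS := by
    rw [(GSSigma.withSeminorms s d).isVonNBounded_iff_seminorm_bounded]
    rintro ⟨h, n⟩
    obtain ⟨A, hA⟩ := hS _ ⟨h, h.2, rfl⟩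
    refine ⟨|A| + 1, by positivity, fun φ hφ => ?_⟩
    exact (GSSigma.stepSeminorms_le n (hA φ hφ)).trans_lt
      ((le_abs_self A).trans_lt (lt_add_one _))

lemma WeightBound.mono_weight {d : ℕ} {v w : (Fin d → ℕ) → (Fin d → ℕ) → ℝ}
    (hvw : ∀ α β, v α β ≤ w α β) {A : ℝ} {f : 𝓢(RPt d, ℂ)} (hf : WeightBound w A f) :
    WeightBound v A f := fun α β x =>
  (mul_le_mul_of_nonneg_right (hvw α β) (by positivity)).trans (hf α β x)

lemma GSSigma.controlledByChains {s : ℝ} (hs : 0 ≤ s) {d : ℕ} {B : Type*}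
    [AddCommGroup B] [Module ℂ B] [QuasiBanachSpace B] {k : GSSigma s d →ₗ[ℂ] B}
    (hk : Continuous k) :
    ControlledByChains (GSSigma.toSchwartzLin s d) {v | ∃ h > 0, v = invWeight d s h} k := by
  intro q
  obtain ⟨I, r, hr, hball⟩ := ((GSSigma.withSeminorms s d).mem_nhds_iff 0 _).1
    (unitBall_preimage_mem_nhds hk)
  obtain ⟨h, hh, hle⟩ : ∃ h : ℝ, 0 < h ∧ ∀ i ∈ I, h ≤ i.1 := by
    clear hball
    induction I using Finset.induction_on with
    | empty => exact ⟨1, one_pos, by simp⟩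
    | insert i I _ ih =>
      obtain ⟨h, hh, hle⟩ := ih
      refine ⟨min i.1 h, lt_min i.1.2 hh, fun i' hi' => ?_⟩
      rcases Finset.mem_insert.1 hi' with rfl | hi'
      · exact min_le_left _ _
      · exact (min_le_right _ _).trans (hle i' hi')
  have hh' : 0 < h / 2 ^ q := by positivity
  obtain ⟨hc1, hc2⟩ := invWeight_chain d hs hh' q
  -- The chain has to end at the `h` that controls `k`, so it starts at `h / 2 ^ q`, which is
  -- available since `Σ_s` carries all the norms.
  refine ⟨fun n => invWeight d s (2 ^ n * (h / 2 ^ q)), ⟨_, by positivity, rfl⟩, hc1, hc2, ?_⟩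
  refine exists_bound_of_unit_bound (r := r / 2) (by positivity) fun φ hφ => hball ?_
  dsimp only at hφ
  rw [mul_div_cancel₀ h (by positivity)] at hφ
  rw [Seminorm.mem_ball_zero]
  refine Seminorm.finset_sup_apply_lt hr fun i hi => ?_
  exact (GSSigma.stepSeminorms_le i.2 (hφ.mono_weight (invWeight_anti s hh (hle i hi)))).trans_lt
    (half_lt_self hr)

/-! ### The Schwartz case -/

/-- The weight that selects the multi-indices of length at most `m`. -/
def cutoffWeight (d m : ℕ) (α β : Fin d → ℕ) : ℝ :=
  if multiLength α ≤ m ∧ multiLength β ≤ m then 1 else 0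

lemma cutoffWeight_nonneg {d m : ℕ} (α β : Fin d → ℕ) : 0 ≤ cutoffWeight d m α β := by
  unfold cutoffWeight; split_ifs <;> norm_num

lemma cutoffWeight_of_le {d m : ℕ} {α β : Fin d → ℕ} (hα : multiLength α ≤ m)
    (hβ : multiLength β ≤ m) : cutoffWeight d m α β = 1 := if_pos ⟨hα, hβ⟩

lemma multiLength_zero {d : ℕ} : multiLength (0 : Fin d → ℕ) = 0 := by simp [multiLength]

lemma cutoffWeight_cases {d m : ℕ} (α β : Fin d → ℕ) :
    cutoffWeight d m α β = 0 ∨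
      cutoffWeight d m α β = 1 ∧ multiLength α ≤ m ∧ multiLength β ≤ m := by
  unfold cutoffWeight; split_ifs with h
  · exact Or.inr ⟨rfl, h⟩
  · exact Or.inl rfl

/-- One unit of admitted length pays for one derivative or one power of a coordinate, and indices of
length at most `m` contribute factors of at most `m`. -/
lemma dominates_cutoffWeight (d m : ℕ) :
    Dominates (m + 1) (cutoffWeight d m) (cutoffWeight d (m + 1)) := by
  have hm : (0 : ℝ) < m + 1 := by positivity
  have h0 : ∀ α β : Fin d → ℕ, 0 ≤ (m + 1 : ℝ) * cutoffWeight d (m + 1) α β := fun α β =>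
    mul_nonneg hm.le (cutoffWeight_nonneg α β)
  have hle : ∀ {n : ℕ}, n ≤ m → (n : ℝ) ≤ m + 1 := fun hn => by
    have : (_ : ℝ) ≤ _ := Nat.cast_le.2 hn
    linarith
  refine ⟨cutoffWeight_nonneg, fun α β i => ?_, fun α β i => ?_, fun α β i => ?_, fun α β i => ?_⟩
  all_goals rcases cutoffWeight_cases (m := m) α β with h | ⟨h, hα, hβ⟩
  all_goals rw [h]
  all_goals try simp only [mul_zero, h0]
  · rw [cutoffWeight_of_le (by omega) (by rw [multiLength_add, multiLength_unitIndex]; omega)]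
    linarith [Nat.cast_nonneg (α := ℝ) m]
  · rw [cutoffWeight_of_le (by rw [multiLength_add, multiLength_unitIndex]; omega) (by omega)]
    linarith [Nat.cast_nonneg (α := ℝ) m]
  · have hsub : multiLength (β - unitIndex i) ≤ multiLength β :=
      Finset.sum_le_sum fun k _ => Nat.sub_le _ _
    rw [cutoffWeight_of_le (by omega) (by omega), mul_one, mul_one]
    exact hle ((le_multiLength β i).trans hβ)
  · rw [cutoffWeight_of_le (by omega) (by omega), mul_one, mul_one]
    exact hle ((le_multiLength α i).trans hα)

lemma schwartzSeminorm_le_of_weightBound {d k n m : ℕ} (hk : k ≤ m) (hn : n ≤ m) {A : ℝ}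
    (hA : 0 ≤ A) {f : 𝓢(RPt d, ℂ)} (hf : WeightBound (cutoffWeight d m) A f) :
    SchwartzMap.seminorm ℂ k n f ≤ (d : ℝ) ^ k * ((d : ℝ) ^ n * A) := by
  refine SchwartzMap.seminorm_le_bound ℂ k n f (by positivity) fun x => ?_
  have h := (isDerivFamily_multiD f).norm_pow_mul_iteratedFDeriv_le k n 0 hA x
    fun γ β hγ hβ => by
      have := hf γ β x
      rw [cutoffWeight_of_le (by omega) (by omega), one_mul] at this
      rwa [zero_add]
  simpa only [multiD_zero] using h

lemma exists_weightBound_cutoffWeight {d : ℕ} (m : ℕ) (f : 𝓢(RPt d, ℂ)) :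
    ∃ A, WeightBound (cutoffWeight d m) A f := by
  obtain ⟨A, hA0, hA⟩ := exists_uniform_bound (exists_monomialAt_mul_multiD_le f) m m
  refine ⟨A, fun α β x => ?_⟩
  rcases cutoffWeight_cases (m := m) α β with h | ⟨h, hα, hβ⟩
  · rw [h, zero_mul]; exact hA0
  · rw [h, one_mul]; exact hA α β hα hβ x

lemma schwartz_isTestSpace (d : ℕ) :
    IsTestSpace (LinearMap.id : 𝓢(RPt d, ℂ) →ₗ[ℂ] 𝓢(RPt d, ℂ))
      (Set.range (cutoffWeight d)) where
  injective := Function.injective_id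
  exists_of_bound ψ _ := ⟨ψ, rfl⟩
  nonneg := by rintro _ ⟨m, rfl⟩ α β; exact cutoffWeight_nonneg α β
  exists_pos α β := ⟨_, ⟨max (multiLength α) (multiLength β), rfl⟩, by
    rw [cutoffWeight_of_le (le_max_left _ _) (le_max_right _ _)]; exact one_pos⟩
  isVonNBounded S hS := by
    rw [(schwartz_withSeminorms ℂ (RPt d) ℂ).isVonNBounded_iff_seminorm_bounded]
    rintro ⟨k, n⟩
    obtain ⟨A, hA⟩ := hS _ ⟨max k n, rfl⟩
    refine ⟨(d : ℝ) ^ k * ((d : ℝ) ^ n * |A|) + 1, by positivity, fun φ hφ => ?_⟩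
    refine (schwartzSeminorm_le_of_weightBound (le_max_left k n) (le_max_right k n)
      (abs_nonneg A) fun α β x => ?_).trans_lt (lt_add_one _)
    exact (hA φ hφ α β x).trans (le_abs_self A)

lemma schwartz_controlledByChains {d : ℕ} {B : Type*} [AddCommGroup B] [Module ℂ B]
    [QuasiBanachSpace B] {k : 𝓢(RPt d, ℂ) →ₗ[ℂ] B} (hk : Continuous k) :
    ControlledByChains LinearMap.id (Set.range (cutoffWeight d)) k := by
  intro q
  obtain ⟨I, r, hr, hball⟩ := ((schwartz_withSeminorms ℂ (RPt d) ℂ).mem_nhds_iff 0 _).1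
    (unitBall_preimage_mem_nhds hk)
  let m := I.sup fun i => max i.1 i.2
  -- The order decreases from `m + q` to the order `m` of the seminorms that control `k`.
  refine ⟨fun n => cutoffWeight d (m + (q - n)), ⟨_, rfl⟩, fun n hn => ?_, fun n hn α β hαβ => ?_, ?_⟩
  · have : m + (q - n) = m + (q - (n + 1)) + 1 := by omega
    dsimp only
    rw [this]
    exact ⟨_, by positivity, dominates_cutoffWeight d _⟩
  · rcases cutoffWeight_cases (m := m + (q - (n + 1))) α β with h | ⟨h, hα, hβ⟩
    · exact absurd h hαβ
    · dsimp only
      rw [cutoffWeight_of_le (by omega) (by rw [multiLength_zero]; omega)]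
      exact one_ne_zero
  -- `c` bounds all the constants of `schwartzSeminorm_le_of_weightBound` for indices in `I`; the
  -- `1` keeps it positive.
  · let c : ℝ := 1 + ∑ i ∈ I, (d : ℝ) ^ i.1 * (d : ℝ) ^ i.2
    have hc : 0 < c := by positivity
    refine exists_bound_of_unit_bound (r := r / (2 * c)) (by positivity) fun φ hφ => hball ?_
    dsimp only at hφ
    rw [Nat.sub_self, add_zero] at hφ
    rw [Seminorm.mem_ball_zero]
    refine Seminorm.finset_sup_apply_lt hr fun i hi => ?_
    have him : max i.1 i.2 ≤ m := Finset.le_sup (f := fun i : ℕ × ℕ => max i.1 i.2) hi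
    refine (schwartzSeminorm_le_of_weightBound ((le_max_left _ _).trans him)
      ((le_max_right _ _).trans him) (by positivity) hφ).trans_lt ?_
    have hic : (d : ℝ) ^ i.1 * (d : ℝ) ^ i.2 ≤ c := by
      have := Finset.single_le_sum (f := fun i : ℕ × ℕ => (d : ℝ) ^ i.1 * (d : ℝ) ^ i.2)
        (fun _ _ => by positivity) hi
      simp only [c]; linarith
    calc (d : ℝ) ^ i.1 * ((d : ℝ) ^ i.2 * (r / (2 * c)))
        = (d : ℝ) ^ i.1 * (d : ℝ) ^ i.2 * (r / (2 * c)) := by ring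
      _ ≤ c * (r / (2 * c)) := by gcongr
      _ = r / 2 := by field_simp
      _ < r := half_lt_self hr

lemma kernelBound_cutoffWeight {d₁ d₂ : ℕ} (m₁ m₂ : ℕ) (K : 𝓢(RPt (d₂ + d₁), ℂ)) :
    ∃ A, KernelBound (cutoffWeight d₂ m₂) (cutoffWeight d₁ m₁) A K := by
  obtain ⟨A, hA⟩ := exists_weightBound_cutoffWeight (m₂ + m₁) K
  refine ⟨A, kernelBound_of_weightBound (fun γ κ α β => ?_) hA⟩
  rcases cutoffWeight_cases (m := m₂) γ κ with h | ⟨h, hγ, hκ⟩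
  · rw [h, zero_mul]; exact cutoffWeight_nonneg _ _
  rcases cutoffWeight_cases (m := m₁) α β with h' | ⟨h', hα, hβ⟩
  · rw [h', mul_zero]; exact cutoffWeight_nonneg _ _
  rw [h, h', cutoffWeight_of_le (by rw [multiLength_append]; omega)
    (by rw [multiLength_append]; omega), one_mul]

end GSKernel

end

theorem theorem4p1 {d₁ d₂ : ℕ}
    {B₁ B₂ : Type*} [AddCommGroup B₁] [Module ℂ B₁] [GSKernel.QuasiBanachSpace B₁]
    [AddCommGroup B₂] [Module ℂ B₂] [GSKernel.QuasiBanachSpace B₂]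
    (ι₁ : B₁ →ₗ[ℂ] GSKernel.GSHalfDual d₁) (ι₂ : B₂ →ₗ[ℂ] GSKernel.GSHalfDual d₂)
    (hι₁ : GSKernel.IsIntermediate ι₁) (hι₂ : GSKernel.IsIntermediate ι₂) :
    (∀ s : ℝ, 1 / 2 ≤ s →
      ∀ (j : B₁ →ₗ[ℂ] StrongDual ℂ (GSKernel.GS s d₁)) (k : GSKernel.GS s d₂ →ₗ[ℂ] B₂),
      GSKernel.IsInclToDual ι₁ GSKernel.GS.toSchwartz j →
      GSKernel.IsInclFromTest ι₂ GSKernel.GS.toSchwartz k →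
      ∀ K : GSKernel.GS s (d₂ + d₁), ∃ T : B₁ →ₗ[ℂ] B₂,
        GSKernel.IsKernelOperator GSKernel.GS.toSchwartz j k (fun x => K.slice x) T ∧
        ∀ p : ℝ≥0∞, 0 < p → GSKernel.MemSchatten p T) ∧
    (∀ s : ℝ, 1 / 2 < s →
      ∀ (j : B₁ →ₗ[ℂ] StrongDual ℂ (GSKernel.GSSigma s d₁))
        (k : GSKernel.GSSigma s d₂ →ₗ[ℂ] B₂),
      GSKernel.IsInclToDual ι₁ GSKernel.GSSigma.toSchwartz j →
      GSKernel.IsInclFromTest ι₂ GSKernel.GSSigma.toSchwartz k →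
      ∀ K : GSKernel.GSSigma s (d₂ + d₁), ∃ T : B₁ →ₗ[ℂ] B₂,
        GSKernel.IsKernelOperator GSKernel.GSSigma.toSchwartz j k (fun x => K.slice x) T ∧
        ∀ p : ℝ≥0∞, 0 < p → GSKernel.MemSchatten p T) ∧
    (∀ (j : B₁ →ₗ[ℂ] StrongDual ℂ 𝓢(GSKernel.RPt d₁, ℂ))
        (k : 𝓢(GSKernel.RPt d₂, ℂ) →ₗ[ℂ] B₂),
      GSKernel.IsInclToDual ι₁ id j →
      GSKernel.IsInclFromTest ι₂ id k →
      ∀ K : 𝓢(GSKernel.RPt (d₂ + d₁), ℂ), ∃ T : B₁ →ₗ[ℂ] B₂,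
        GSKernel.IsKernelOperator id j k (fun x => GSKernel.sliceS x K) T ∧
        ∀ p : ℝ≥0∞, 0 < p → GSKernel.MemSchatten p T) := by
  refine ⟨fun s hs j k hj hk K => ?_, fun s hs j k hj hk K => ?_, fun j k hj hk K => ?_⟩
  · have hs0 : (0 : ℝ) ≤ s := by linarith
    -- The `h` of the kernel determines the weights in both variables.
    obtain ⟨h, hK⟩ := K.2
    obtain ⟨A, hA⟩ := GSKernel.mem_gsStepSubmodule_iff.1 hK
    refine GSKernel.exists_kernelOperator (GSKernel.GS.isTestSpace s d₁ h)
      (GSKernel.GS.isTestSpace s d₂ h) (K := K.toSchwartz) ?_ hj.continuous (fun _ => rfl)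
      (GSKernel.GS.controlledByChains hs0 h hk.continuous)
    rintro _ rfl _ rfl
    exact ⟨A, GSKernel.kernelBound_invWeight h.2 le_rfl le_rfl hA⟩
  · have hs0 : (0 : ℝ) ≤ s := by linarith
    refine GSKernel.exists_kernelOperator (GSKernel.GSSigma.isTestSpace s d₁)
      (GSKernel.GSSigma.isTestSpace s d₂) (K := K.toSchwartz) ?_ hj.continuous (fun _ => rfl)
      (GSKernel.GSSigma.controlledByChains hs0 hk.continuous)
    rintro _ ⟨h₂, hh₂, rfl⟩ _ ⟨h₁, hh₁, rfl⟩
    -- A bound for `K` at the smaller parameter implies the one for the pair `h₁`, `h₂`.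
    have hmin : 0 < min h₁ h₂ := lt_min hh₁ hh₂
    obtain ⟨A, hA⟩ := GSKernel.mem_gsStepSubmodule_iff.1
      ((Submodule.mem_iInf _).1 K.2 ⟨min h₁ h₂, hmin⟩)
    exact ⟨A, GSKernel.kernelBound_invWeight hmin (min_le_left _ _) (min_le_right _ _) hA⟩
  · refine GSKernel.exists_kernelOperator (GSKernel.schwartz_isTestSpace d₁)
      (GSKernel.schwartz_isTestSpace d₂) (K := K) ?_ hj.continuous (fun _ => rfl)
      (GSKernel.schwartz_controlledByChains hk.continuous)
    rintro _ ⟨m₂, rfl⟩ _ ⟨m₁, rfl⟩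
    exact GSKernel.kernelBound_cutoffWeight m₁ m₂ K
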